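/- Let $n\ge 0$, and consider representations of $S_n$ over $\mathbb C$. Partitions of $n$ index the conjugacy classes of $S_n$, a fixed point counting as a cycle of length $1$; let $\mathrm{Par}_n^{odd}$ be the set of partitions of $n$ with all parts odd. For a partition $\lambda\vdash n$ let $\sigma_\lambda\in S_n$ have cycle type $\lambda$, let $Z_\lambda$ be its centraliser in $S_n$, and let $\mathrm{tw}_\lambda: Z_\lambda\to\{\pm1\}$ be the linear character $$\mathrm{tw}_\lambda(g)=\prod_{i\ge 1}\operatorname{sgn}\bigl(g \text{ acting on the set of cycles of length } i \text{ of } \sigma_\lambda\bigr).$$ The twisted conjugacy module is $$\varepsilon(S_n)=\bigoplus_{\lambda\vdash n}\mathrm{tw}_\lambda\uparrow_{Z_\lambda}^{S_n}.$$ For a representation $V$ of $S_n$ with character $\chi_V$ let $ch(V)=\frac1{n!}\sum_{g\in S_n}\chi_V(g)\,p_{\mathrm{type}(g)}$ be its Frobenius characteristic, where $p_\lambda=\prod_j p_{\lambda_j}$ is the power-sum symmetric function. Let $f_i=ch(1\uparrow_{C_i}^{S_i})$ for $i\geq 1$, where $C_i$ is generated by an $i$-cycle, let $e_m$ be the elementary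 symmetric functions, and let $e_m[f_i]$ denote plethysm. Then: 1. $$ch(\varepsilon(S_n))=\sum_{\lambda\vdash n}\ \prod_{i} e_{m_i(\lambda)}[f_i]=\sum_{\lambda\in \mathrm{Par}_n^{odd}}p_\lambda,$$ where $i$ runs over the distinct parts of $\lambda$ and $m_i(\lambda)$ is the multiplicity of $i$ in $\lambda$. 2. $\varepsilon(S_n)$ is self-conjugate, that is, $\varepsilon(S_n)\otimes\mathrm{sgn}\cong\varepsilon(S_n)$, and it has degree $n!$. 3. If $\chi^\nu$ denotes the irreducible character of $S_n$ indexed by the partition $\nu$ of $n$, and $\chi^\nu(\lambda)$ its value on the class of cycle type $\lambda$, then for every $\nu\vdash n$ the sum $\sum_{\lambda\in \mathrm{Par}_n^{odd}}\chi^\nu(\lambda)$ is a nonnegative integer. -/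

import Mathlib

noncomputable section

namespace TwistedConj

open Equiv Equiv.Perm
open scoped Pointwise

/-! ### Partitions and cycle types -/

/-- `σ` has cycle type `l`, where fixed points are counted as parts equal to `1`. -/
def HasType {n : ℕ} (σ : Perm (Fin n)) (l : n.Partition) : Prop :=
  σ.partition.parts = l.parts

theorem exists_hasType {n : ℕ} (l : n.Partition) : ∃ σ : Perm (Fin n), HasType σ l := by
  have hle : (l.parts.filter (2 ≤ ·)).sum ≤ n := by
    have h := congrArg Multiset.sum (Multiset.filter_add_not (2 ≤ ·) l.parts)
    rw [Multiset.sum_add, l.parts_sum] at h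
    omega
  obtain ⟨σ, hσ⟩ := (Equiv.Perm.exists_with_cycleType_iff (Fin n)
    (m := l.parts.filter (2 ≤ ·))).2
      ⟨by simpa using hle, fun a ha => (Multiset.mem_filter.1 ha).2⟩
  refine ⟨σ, ?_⟩
  have hone : l.parts.filter (fun a => ¬ 2 ≤ a)
      = Multiset.replicate (Multiset.card (l.parts.filter (fun a => ¬ 2 ≤ a))) 1 := by
    refine Multiset.eq_replicate_card.2 fun b hb => ?_
    have h1 := l.parts_pos (Multiset.mem_filter.1 hb).1
    have h2 := (Multiset.mem_filter.1 hb).2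
    omega
  have h := congrArg Multiset.sum (Multiset.filter_add_not (2 ≤ ·) l.parts)
  rw [Multiset.sum_add, l.parts_sum, hone, Multiset.sum_replicate, smul_eq_mul, mul_one,
    ← hσ, Equiv.Perm.sum_cycleType] at h
  unfold HasType
  rw [Equiv.Perm.parts_partition, Fintype.card_fin]
  conv_rhs => rw [← Multiset.filter_add_not (2 ≤ ·) l.parts, hone]
  rw [hσ]
  congr 2
  omega

/-- A representative of the conjugacy class of cycle type `l`. -/
def rep {n : ℕ} (l : n.Partition) : Perm (Fin n) := (exists_hasType l).choose

theorem rep_hasType {n : ℕ} (l : n.Partition) : HasType (rep l) l := (exists_hasType l).choose_spec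

/-! ### The sign twist on a centraliser -/

/-- The underlying sets of the cycles of `σ` of length `i`; the cycles of length `1` are the
fixed points. -/
def cyclesOfLength {n : ℕ} (σ : Perm (Fin n)) (i : ℕ) : Finset (Finset (Fin n)) :=
  (Finset.univ.image fun x => Finset.univ.filter fun y => σ.SameCycle x y).filter
    fun c => c.card = i

theorem smul_mem_cyclesOfLength {n : ℕ} (σ g : Perm (Fin n)) (hg : g * σ = σ * g) (i : ℕ)
    {c : Finset (Fin n)} (hc : c ∈ cyclesOfLength σ i) : g • c ∈ cyclesOfLength σ i := by
  simp only [cyclesOfLength, Finset.mem_filter, Finset.mem_image, Finset.mem_univ,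
    true_and] at hc ⊢
  obtain ⟨⟨x, rfl⟩, hi⟩ := hc
  refine ⟨⟨g x, ?_⟩, by simpa using hi⟩
  have hconj : g * σ * g⁻¹ = σ := by rw [hg, mul_inv_cancel_right]
  ext y
  rw [← Finset.inv_smul_mem_iff]
  simp only [Finset.mem_filter, Finset.mem_univ, true_and, Equiv.Perm.smul_def]
  conv_lhs => rw [← hconj, sameCycle_conj]
  simp

theorem smul_mem_cyclesOfLength_iff {n : ℕ} (σ : Perm (Fin n))
    (g : Subgroup.centralizer {σ}) (i : ℕ) (c : Finset (Fin n)) :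
    MulAction.toPermHom (Perm (Fin n)) (Finset (Fin n)) g c ∈ cyclesOfLength σ i ↔
      c ∈ cyclesOfLength σ i := by
  have hg : (g : Perm (Fin n)) * σ = σ * g := Subgroup.mem_centralizer_singleton_iff.1 g.2
  refine ⟨fun h => ?_, fun h => smul_mem_cyclesOfLength σ g hg i h⟩
  have hg' : (g : Perm (Fin n))⁻¹ * σ = σ * (g : Perm (Fin n))⁻¹ := by
    rw [inv_mul_eq_iff_eq_mul, ← mul_assoc, hg, mul_inv_cancel_right]
  simpa using smul_mem_cyclesOfLength σ _ hg' i h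

/-- The centraliser of `σ` permutes the cycles of `σ` of length `i`. -/
def cycleAction {n : ℕ} (σ : Perm (Fin n)) (i : ℕ) :
    Subgroup.centralizer {σ} →* Perm {c // c ∈ cyclesOfLength σ i} where
  toFun g := (MulAction.toPermHom (Perm (Fin n)) (Finset (Fin n)) g).subtypePerm
    (smul_mem_cyclesOfLength_iff σ g i)
  map_one' := by ext; simp
  map_mul' g h := by
    refine Equiv.ext fun c => Subtype.ext ?_
    exact mul_smul (g : Perm (Fin n)) (h : Perm (Fin n)) (c : Finset (Fin n))

/-- The linear character of the centraliser of `σ` which, for every `i`, permutes the cycles of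
length `i` by the sign and is trivial within each cycle. -/
def twistSign {n : ℕ} (σ : Perm (Fin n)) : Subgroup.centralizer {σ} →* ℤˣ :=
  ∏ i ∈ Finset.Icc 1 n, sign.comp (cycleAction σ i)

/-- The one-dimensional complex representation given by a character with values in `{1, -1}`. -/
def linRep {G : Type} [Group G] (χ : G →* ℤˣ) : Representation ℂ G ℂ where
  toFun g := ((χ g : ℤ) : ℂ) • LinearMap.id
  map_one' := by ext; simp
  map_mul' g h := by ext; simp [mul_comm]

/-! ### The twisted conjugacy module -/

/-- The module induced to `S_n` from the centraliser of a permutation of cycle type `l`,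
where blocks of equal cycles are permuted by the sign. -/
abbrev twistedClass {n : ℕ} (l : n.Partition) :=
  Representation.ind (Subgroup.centralizer {rep l}).subtype (linRep (twistSign (rep l)))

/-- The underlying space of the twisted conjugacy module. -/
abbrev TwistedSpace (n : ℕ) : Type :=
  DirectSum n.Partition fun l =>
    Representation.IndV (Subgroup.centralizer {rep l}).subtype (linRep (twistSign (rep l)))

/-- The twisted conjugacy module `ε(S_n)`: the sum of the modules induced from the centralisers,
over all conjugacy classes. -/
abbrev twistedConj (n : ℕ) : Representation ℂ (Perm (Fin n)) (TwistedSpace n) :=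
  Representation.directSum fun l : n.Partition => twistedClass l

/-- The sign representation of `S_n`. -/
abbrev sgnRep (n : ℕ) : Representation ℂ (Perm (Fin n)) ℂ := linRep sign

/-- The permutation module `1↑_{C_n}^{S_n}`, where `C_n` is generated by an `n`-cycle. -/
abbrev indCyclic (n : ℕ) :=
  Representation.ind (Subgroup.zpowers (finRotate n)).subtype
    (Representation.trivial ℂ (Subgroup.zpowers (finRotate n)) ℂ)

/-! ### Symmetric functions, as formal power series in `x₀, x₁, x₂, …` -/

/-- The power sum `p_k = ∑ᵢ xᵢ ^ k`, for `k ≥ 1`. -/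
def pSym (k : ℕ) : MvPowerSeries ℕ ℂ :=
  open Classical in fun m => if ∃ i, m = Finsupp.single i k then 1 else 0

/-- The elementary symmetric function `e_k`, the sum of all squarefree monomials of degree `k`. -/
def eSym (k : ℕ) : MvPowerSeries ℕ ℂ :=
  open Classical in fun m => if (∀ i, m i ≤ 1) ∧ m.degree = k then 1 else 0

/-- The power sum `p_l = ∏ p_{l_i}` of a partition. -/
def pPart {n : ℕ} (l : n.Partition) : MvPowerSeries ℕ ℂ := (l.parts.map pSym).prod

/-- The Frobenius characteristic `(1 / n!) ∑_g χ(g) p_{type g}` of a representation of `S_n`. -/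
def frob {n : ℕ} {V : Type} [AddCommGroup V] [Module ℂ V]
    (ρ : Representation ℂ (Perm (Fin n)) V) : MvPowerSeries ℕ ℂ :=
  (n.factorial : ℂ)⁻¹ • ∑ g : Perm (Fin n), ρ.character g • pPart g.partition

/-- The plethysm `f[g]`: write `f` as a polynomial in the power sums `p_k`, and replace each `p_k`
by `p_k[g] = g(x₀ ^ k, x₁ ^ k, …)`. -/
def plethysm (f g : MvPowerSeries ℕ ℂ) : MvPowerSeries ℕ ℂ :=
  open Classical in
  if h : ∃ P : MvPolynomial ℕ+ ℂ, MvPolynomial.aeval (fun k : ℕ+ => pSym k) P = f then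
    MvPolynomial.aeval (fun k : ℕ+ => MvPowerSeries.expand (k : ℕ) k.ne_zero g) h.choose
  else 0

/-- `E_l[Q] = ∏ e_{m_i}[q_i]`, over the parts `i` of `l`, `m_i` being the multiplicity of `i`. -/
def ePleth {n : ℕ} (l : n.Partition) (q : ℕ → MvPowerSeries ℕ ℂ) : MvPowerSeries ℕ ℂ :=
  ∏ i ∈ l.parts.toFinset, plethysm (eSym (l.parts.count i)) (q i)

/-! ### The irreducible characters of `S_n` -/

/-- The parts of `ν` in weakly decreasing order. -/
def rowLens {n : ℕ} (ν : n.Partition) : List ℕ := ν.parts.sort (· ≥ ·)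

theorem sum_rowLens {n : ℕ} (ν : n.Partition) :
    ∑ r : Fin (rowLens ν).length, (rowLens ν).get r = n := by
  have h : ((rowLens ν : List ℕ) : Multiset ℕ).sum = n := by
    rw [rowLens, Multiset.sort_eq, ν.parts_sum]
  rw [Multiset.sum_coe] at h
  simpa [Fin.sum_univ_getElem] using h

/-- The tableau of shape `ν` filled with `0, …, n - 1` row by row: the cell `⟨r, c⟩` is the `c`-th
cell of the `r`-th row. -/
def tableau {n : ℕ} (ν : n.Partition) :
    (Σ r : Fin (rowLens ν).length, Fin ((rowLens ν).get r)) ≃ Fin n :=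
  finSigmaFinEquiv.trans (finCongr (sum_rowLens ν))

/-- The row of the entry `x` of the tableau. -/
def rowOf {n : ℕ} (ν : n.Partition) (x : Fin n) : ℕ := ((tableau ν).symm x).1

/-- The column of the entry `x` of the tableau. -/
def colOf {n : ℕ} (ν : n.Partition) (x : Fin n) : ℕ := ((tableau ν).symm x).2

/-- The Young symmetrizer `(∑_{g ∈ P} g) (∑_{h ∈ Q} sgn(h) h)`, where `P` and `Q` are the row and
the column group of the tableau. -/
def youngSymmetrizer {n : ℕ} (ν : n.Partition) : MonoidAlgebra ℂ (Perm (Fin n)) :=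
  (∑ g : Perm (Fin n) with ∀ x, rowOf ν (g x) = rowOf ν x, MonoidAlgebra.of ℂ _ g) *
  (∑ h : Perm (Fin n) with ∀ x, colOf ν (h x) = colOf ν x,
    ((sign h : ℤ) : ℂ) • MonoidAlgebra.of ℂ _ h)

/-- The irreducible (Specht) module of `S_n` indexed by `ν`: the left ideal of the group algebra
generated by the Young symmetrizer. -/
abbrev specht {n : ℕ} (ν : n.Partition) :=
  Representation.ofModule' (k := ℂ) (G := Perm (Fin n))
    ↥(Ideal.span {youngSymmetrizer ν} : Ideal (MonoidAlgebra ℂ (Perm (Fin n))))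

/-- The value `χ^ν(l)` of the irreducible character indexed by `ν` on the class of type `l`. -/
def irrChar {n : ℕ} (ν l : n.Partition) : ℂ := (specht ν).character (rep l)

end TwistedConj

end

/-! Write r(σ, g) for the number of orbits of the group generated by commuting permutations σ and g.
These orbits are the g-orbits on the cycles of σ, and all cycles in one orbit have equal length.
Since a sign is the parity of degree plus orbit number, the twist equals sgn(σ)(-1)^(n + r(σ, g))
(`twistSign_apply`). Summing induced characters over all classes, the character of ε(S_n) at g is
the sum of this quantity over all σ commuting with g.

If all cycles of g are odd, g has odd order, a ±1-valued character is trivial on it, and the sum is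
|Z(g)|. Otherwise let γ be a cycle of g of even length: replacing σ by σγ keeps commutation with g
and the joint orbits but flips sgn(σ), so the sum vanishes (`sum_twistValue_of_not_odd`). Pairing
this character (`character_twistedConj`) with class functions gives the power-sum expansion and the
multiplicities of irreducibles as Hom dimensions; its value at 1 gives the degree, and its support
on even permutations gives self-conjugacy.

The plethystic sum is compared with the power-sum expansion through recursions. The series ∏_i ∑_c
e_c[f_i] t^(ic) has a logarithmic derivative governed by ∑_{ik=s} (-1)^(k-1) i p_k[f_i], by Newton's
identities. As i f_i = ∑_{de=i} φ(d) p_d^e, this is a sum over kde = s of (-1)^(k-1) φ(d) p_{kd}^e.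
Grouping by m = kd, the inner sum is m for odd m and 0 for even m, which is what ∏_{i odd} 1/(1 -
p_i t^i) yields (`sum_mul_newtonCoeff`, `sum_multWeight_congr`). Plethysm is independent of choices
because the power sums are algebraically independent (`pSym_injective`). -/

noncomputable section

/-! ### Characters of direct sums, coinvariants and induced representations -/

namespace Representation

variable {k G : Type*} [Field k] [Group G]

/-- The character of a finite direct sum is the sum of the characters. -/
theorem character_directSum {ι : Type*} [Fintype ι] {V : ι → Type*}
    [∀ i, AddCommGroup (V i)] [∀ i, Module k (V i)] [∀ i, FiniteDimensional k (V i)]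
    (ρ : ∀ i, Representation k G (V i)) (g : G) :
    (directSum ρ).character g = ∑ i, (ρ i).character g := by
  classical
  have hsum : directSum ρ g =
      ∑ i, DirectSum.lof k ι V i ∘ₗ (ρ i g ∘ₗ DirectSum.component k ι V i) := by
    refine LinearMap.ext fun x => ?_
    refine DirectSum.ext_component k fun j => ?_
    simp only [LinearMap.coe_sum, Finset.sum_apply, map_sum, LinearMap.comp_apply]
    rw [Finset.sum_eq_single j]
    · rw [DirectSum.component.lof_self]
      rfl
    · intro i _ hij
      exact (DirectSum.component.of k _ _ _).trans (dif_neg hij)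
    · simp
  have : Module.Finite k (DirectSum ι V) := Module.Finite.equiv (DirectSum.linearEquivFunOnFintype k ι V).symm
  rw [character, hsum, map_sum]
  refine Finset.sum_congr rfl fun i _ => ?_
  rw [LinearMap.trace_comp_comm', LinearMap.comp_assoc, character]
  congr 1
  refine LinearMap.ext fun x => ?_
  simp

/-- The trace of an endomorphism induced on the coinvariants of a finite group is the average of
the traces of its translates. -/
theorem trace_coinvariants_map [Fintype G] {V : Type*} [AddCommGroup V] [Module k V]
    [FiniteDimensional k V] [NeZero (Fintype.card G : k)] (τ : Representation k G V)
    (f : IntertwiningMap τ τ) :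
    LinearMap.trace k _ (Coinvariants.map τ τ f) =
      (Fintype.card G : k)⁻¹ * ∑ h : G, LinearMap.trace k V (f.toLinearMap ∘ₗ τ h) := by
  -- Averaging over the group factors through the coinvariants and gives a section of the quotient
  -- map; cyclicity of the trace then moves the computation back to V.
  set P : V →ₗ[k] V := (Fintype.card G : k)⁻¹ • ∑ h : G, τ h with hP
  have hinv : ∀ x, P ∘ₗ τ x = P := fun x => by
    rw [hP, LinearMap.smul_comp]
    congr 1
    refine LinearMap.ext fun v => ?_
    simp only [LinearMap.comp_apply, LinearMap.sum_apply]
    refine Fintype.sum_equiv (Equiv.mulRight x) _ _ fun h => ?_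
    rw [Equiv.coe_mulRight, map_mul, Module.End.mul_apply]
  have hsec : Coinvariants.mk τ ∘ₗ Coinvariants.lift τ P hinv = LinearMap.id := by
    refine Coinvariants.hom_ext (LinearMap.ext fun v => ?_)
    simp only [LinearMap.comp_apply, Coinvariants.lift_mk, hP, LinearMap.smul_apply,
      LinearMap.sum_apply, map_smul, map_sum, Coinvariants.mk_self_apply, LinearMap.id_apply,
      Finset.sum_const, Finset.card_univ]
    rw [← Nat.cast_smul_eq_nsmul k, smul_smul, inv_mul_cancel₀ (NeZero.ne _), one_smul]
  rw [← LinearMap.comp_id (Coinvariants.map τ τ f), ← hsec, ← LinearMap.comp_assoc,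
    Coinvariants.map_comp_mk, LinearMap.trace_comp_comm', ← LinearMap.comp_assoc,
    Coinvariants.lift_comp_mk, LinearMap.trace_comp_comm', hP, LinearMap.comp_smul, map_smul,
    smul_eq_mul, ← map_sum (LinearMap.trace k V)]
  congr 2
  refine LinearMap.ext fun v => ?_
  simp [LinearMap.sum_apply]

/-- The character of a representation induced along a homomorphism of finite groups. -/
theorem character_ind {H : Type*} [Fintype G] [Fintype H] [DecidableEq H] [Group H]
    [NeZero (Fintype.card G : k)] (φ : G →* H) {A : Type*} [AddCommGroup A] [Module k A]
    [FiniteDimensional k A] (ρ : Representation k G A) (g : H) :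
    (ind φ ρ).character g = (Fintype.card G : k)⁻¹ *
      ∑ h : G, ρ.character h * (Fintype.card {x : H // φ h * x = x * g} : k) := by
  have : Module.Finite k (MonoidAlgebra k H) := Module.Finite.equiv (MonoidAlgebra.coeffLinearEquiv k).symm
  rw [character, ind_apply, trace_coinvariants_map]
  congr 1
  refine Finset.sum_congr rfl fun h _ => ?_
  have hcomp : (MonoidAlgebra.mapDomainLinearMap k k fun x : H => x * g⁻¹).rTensor A ∘ₗ
      (Representation.tprod ((leftRegular k H).comp φ) ρ) h =
      TensorProduct.map (MonoidAlgebra.mapDomainLinearMap k k fun x : H => φ h * x * g⁻¹) (ρ h) := by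
    ext; simp
  refine (congrArg _ hcomp).trans ?_
  -- The trace on the group algebra counts the basis elements x with φ(h) x g⁻¹ = x.
  rw [LinearMap.trace_tensorProduct', mul_comm, character]
  congr 1
  rw [LinearMap.trace_eq_matrix_trace k (MonoidAlgebra.basis H k), Matrix.trace,
    Fintype.card_subtype, Finset.natCast_card_filter]
  refine Finset.sum_congr rfl fun x _ => ?_
  rw [Matrix.diag_apply, LinearMap.toMatrix_apply]
  simp [MonoidAlgebra.basis, Finsupp.single_apply, mul_inv_eq_iff_eq_mul]

/-! ### Semisimple modules and the dimensions of their Hom spaces -/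

section

variable {k R : Type*} [Field k] [Ring R] [Algebra k R]

theorem finite_linearMap_of_isScalarTower (S V : Type*) [AddCommGroup S] [Module k S] [Module R S]
    [IsScalarTower k R S] [Module.Finite k S] [AddCommGroup V] [Module k V] [Module R V]
    [IsScalarTower k R V] [Module.Finite k V] : Module.Finite k (S →ₗ[R] V) :=
  Module.Finite.of_injective (LinearMap.restrictScalarsₗ k R S V k)
    (LinearMap.restrictScalars_injective k)

/-- Postcomposition with a linear equivalence, linear over a base field. -/
def homCongrRight (k : Type*) [Field k] [Algebra k R] (T : Type*) {A B : Type*} [AddCommGroup T]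
    [Module R T] [AddCommGroup A] [Module k A] [Module R A] [IsScalarTower k R A] [AddCommGroup B]
    [Module k B] [Module R B] [IsScalarTower k R B] (e : A ≃ₗ[R] B) :
    (T →ₗ[R] A) ≃ₗ[k] (T →ₗ[R] B) where
  toFun f := e.toLinearMap ∘ₗ f
  invFun f := e.symm.toLinearMap ∘ₗ f
  left_inv f := by ext; simp
  right_inv f := by ext; simp
  map_add' f g := by ext; simp
  map_smul' c f := by
    ext x
    exact (e.restrictScalars k).map_smul c (f x)

/-- Finite-dimensional modules over a semisimple algebra are isomorphic if, for every module `S`,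
the spaces of homomorphisms from `S` have the same dimension. -/
theorem nonempty_linearEquiv_of_finrank_hom_eq [IsSemisimpleRing R] (n : ℕ) :
    ∀ (V W : Type) [AddCommGroup V] [Module k V] [Module R V] [IsScalarTower k R V]
      [Module.Finite k V] [AddCommGroup W] [Module k W] [Module R W] [IsScalarTower k R W]
      [Module.Finite k W], Module.finrank k V = n →
      (∀ (S : Type) [AddCommGroup S] [Module k S] [Module R S] [IsScalarTower k R S]
        [Module.Finite k S], Module.finrank k (S →ₗ[R] V) = Module.finrank k (S →ₗ[R] W)) →
      Nonempty (V ≃ₗ[R] W) := by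
  induction n using Nat.strong_induction_on with
  | _ n ih =>
    intro V W _ _ _ _ _ _ _ _ _ _ hn hVW
    have hfin := @finite_linearMap_of_isScalarTower k R _ _ _
    rcases subsingleton_or_nontrivial V with hV | hV
    -- For V = 0, testing against W itself forces the identity of W to vanish.
    · have h0 := hVW W
      have := hfin W W
      rw [Module.finrank_zero_of_subsingleton, eq_comm, Module.finrank_zero_iff] at h0
      have : Subsingleton W := ⟨fun a b => by
        rw [← LinearMap.id_apply (R := R) a, ← LinearMap.id_apply (R := R) b,
          Subsingleton.elim (LinearMap.id : W →ₗ[R] W) 0]; simp⟩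
      exact ⟨0⟩
    -- A simple submodule S of V also embeds in W, because Hom(S, V) ≠ 0. Splitting S off both sides
    -- lowers the dimension, and additivity of Hom lets the contributions of S cancel.
    · obtain ⟨S, hS⟩ := IsSemisimpleModule.exists_simple_submodule R V
      have hkS : Module.Finite k S := inferInstanceAs (Module.Finite k (S.restrictScalars k))
      have hne : ∃ f : S →ₗ[R] W, f ≠ 0 := by
        by_contra! hcon
        have : Subsingleton (S →ₗ[R] W) := ⟨fun a b => by rw [hcon a, hcon b]⟩
        have h0 := hVW S
        have := hfin S V
        rw [Module.finrank_zero_of_subsingleton (M := S →ₗ[R] W), Module.finrank_zero_iff] at h0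
        have := IsSimpleModule.nontrivial R S
        obtain ⟨x, hx⟩ := exists_ne (0 : S)
        exact hx (Subtype.ext (congrArg (fun f : S →ₗ[R] V => f x)
          (Subsingleton.elim S.subtype 0)))
      obtain ⟨f, hf⟩ := hne
      have hinj : Function.Injective f := (LinearMap.injective_or_eq_zero f).resolve_right hf
      let e : S ≃ₗ[R] LinearMap.range f := LinearEquiv.ofInjective f hinj
      obtain ⟨V', hV'⟩ := exists_isCompl S
      obtain ⟨W', hW'⟩ := exists_isCompl (LinearMap.range f)
      have hkV' : Module.Finite k V' := inferInstanceAs (Module.Finite k (V'.restrictScalars k))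
      have hkW' : Module.Finite k W' := inferInstanceAs (Module.Finite k (W'.restrictScalars k))
      let eV : (S × V') ≃ₗ[R] V := Submodule.prodEquivOfIsCompl S V' hV'
      let eW : (S × W') ≃ₗ[R] W := (e.prodCongr (LinearEquiv.refl R W')).trans
        (Submodule.prodEquivOfIsCompl _ W' hW')
      have hS0 : 0 < Module.finrank k S := by
        have := IsSimpleModule.nontrivial R S
        exact Module.finrank_pos
      have hlt : Module.finrank k V' < n := by
        have := (eV.restrictScalars k).finrank_eq
        rw [Module.finrank_prod] at this
        omega
      have hsplit : ∀ (T : Type) [AddCommGroup T] [Module k T] [Module R T] [IsScalarTower k R T]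
          [Module.Finite k T] (A B C : Type) [AddCommGroup A] [Module k A] [Module R A]
          [IsScalarTower k R A] [Module.Finite k A] [AddCommGroup B] [Module k B] [Module R B]
          [IsScalarTower k R B] [Module.Finite k B] [AddCommGroup C] [Module k C] [Module R C]
          [IsScalarTower k R C] [Module.Finite k C] (_ : (A × B) ≃ₗ[R] C),
          Module.finrank k (T →ₗ[R] C) =
            Module.finrank k (T →ₗ[R] A) + Module.finrank k (T →ₗ[R] B) := by
        intro T _ _ _ _ _ A B C _ _ _ _ _ _ _ _ _ _ _ _ _ _ _ E
        have := hfin T A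
        have := hfin T B
        rw [← Module.finrank_prod]
        refine LinearEquiv.finrank_eq (LinearEquiv.symm ?_)
        exact (LinearMap.prodEquiv k).trans (homCongrRight k T E)
      obtain ⟨e'⟩ := ih _ hlt V' W' rfl fun T _ _ _ _ _ => by
        have h1 := hVW T
        rw [hsplit T S V' V eV, hsplit T S W' W eW] at h1
        omega
      exact ⟨eV.symm.trans (((LinearEquiv.refl R S).prodCongr e').trans eW)⟩

end

/-- Representations of a finite group in characteristic zero with the same character are
isomorphic. -/
theorem nonempty_equiv_of_character_eq {k G : Type} [Field k] [CharZero k] [Group G] [Fintype G]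
    {V W : Type} [AddCommGroup V] [Module k V] [FiniteDimensional k V] [AddCommGroup W]
    [Module k W] [FiniteDimensional k W] (ρ : Representation k G V) (σ : Representation k G W)
    (h : ρ.character = σ.character) : Nonempty (ρ.Equiv σ) := by
  have : NeZero (Nat.card G : k) := ⟨Nat.cast_ne_zero.2 Nat.card_pos.ne'⟩
  have : Invertible (Nat.card G : k) := invertibleOfNonzero (NeZero.ne _)
  -- The dimension of the intertwiners out of a representation τ is a pairing of characters, so it
  -- depends on the target only through its character.
  obtain ⟨e⟩ := nonempty_linearEquiv_of_finrank_hom_eq (k := k) (R := MonoidAlgebra k G) _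
    ρ.asModule σ.asModule rfl (by
      intro S _ _ _ _ _
      let τ : Representation k G S := ofModule' S
      have hτ : ∀ (r : MonoidAlgebra k G) (x : τ.asModule),
          τ.asModuleEquiv (r • x) = r • τ.asModuleEquiv x := fun r x => by
        rw [asModuleEquiv_map_smul]
        have : τ.asAlgebraHom = Algebra.lsmul k k S :=
          (MonoidAlgebra.lift k (S →ₗ[k] S) G).apply_symm_apply _
        rw [this]; rfl
      let e : τ.asModule ≃ₗ[MonoidAlgebra k G] S :=
        { τ.asModuleEquiv.toAddEquiv with map_smul' := hτ }
      rw [(e.symm.congrLeft ρ.asModule k).finrank_eq,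
        (e.symm.congrLeft σ.asModule k).finrank_eq,
        ← (IntertwiningMap.equivLinearMapAsModule τ ρ).finrank_eq,
        ← (IntertwiningMap.equivLinearMapAsModule τ σ).finrank_eq]
      have h1 := card_inv_mul_sum_char_mul_char_eq_finrank τ ρ
      have h2 := card_inv_mul_sum_char_mul_char_eq_finrank τ σ
      rw [h, h2] at h1
      exact_mod_cast h1.symm)
  refine ⟨Equiv.mk (e.restrictScalars k) fun g => LinearMap.ext fun v => ?_⟩
  have := e.map_smul (MonoidAlgebra.of k G g) (ρ.asModuleEquiv.symm v)
  rw [← asModuleEquiv_symm_map_rho] at this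
  refine this.trans ?_
  exact (asModuleEquiv_symm_map_rho σ g (σ.asModuleEquiv (e (ρ.asModuleEquiv.symm v)))).symm

end Representation

namespace TwistedConj

open Equiv Equiv.Perm
open scoped Pointwise

/-! ### Counting orbits of permutations -/

theorem card_quotient_eq_card_image {α β : Type*} [Fintype α] [DecidableEq β] (s : Setoid α)
    (f : α → β) (hf : ∀ x y, f x = f y ↔ s x y) :
    Nat.card (Quotient s) = (Finset.univ.image f).card := by
  have hs : s = Setoid.ker f := Setoid.ext fun x y => (hf x y).symm
  subst hs
  rw [Nat.card_congr (Setoid.quotientKerEquivRange f), ← Set.image_univ, ← Finset.coe_univ,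
    ← Finset.coe_image, Nat.card_eq_fintype_card]
  exact Fintype.card_coe _

theorem card_quotient_congr {α β : Type*} (s : Setoid α) (t : Setoid β) (f : α → β)
    (hf : Function.Surjective f) (h : ∀ x y, s x y ↔ t (f x) (f y)) :
    Nat.card (Quotient s) = Nat.card (Quotient t) := by
  refine Nat.card_congr (Equiv.ofBijective (Quotient.map f fun x y => (h x y).1) ⟨?_, ?_⟩)
  · rintro ⟨x⟩ ⟨y⟩ hxy
    exact Quotient.sound ((h x y).2 (Quotient.exact hxy))
  · rintro ⟨y⟩
    obtain ⟨x, rfl⟩ := hf y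
    exact ⟨Quotient.mk _ x, rfl⟩

/-- The underlying set of the cycle of `π` through `x`. -/
def cycleSet {α : Type*} [Fintype α] [DecidableEq α] (π : Perm α) (x : α) : Finset α :=
  Finset.univ.filter fun y => π.SameCycle x y

section

variable {α : Type*} [Fintype α] [DecidableEq α]

theorem mem_cycleSet {π : Perm α} {x y : α} : y ∈ cycleSet π x ↔ π.SameCycle x y := by
  simp [cycleSet]

theorem cycleSet_eq_iff {π : Perm α} {x y : α} :
    cycleSet π x = cycleSet π y ↔ π.SameCycle x y := by
  refine ⟨fun h => ?_, fun h => ?_⟩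
  · rw [← mem_cycleSet, h, mem_cycleSet]
  · ext z
    rw [mem_cycleSet, mem_cycleSet]
    exact ⟨fun hz => h.symm.trans hz, fun hz => h.trans hz⟩

/-- The sign of a permutation is determined by the number of its orbits. -/
theorem sign_eq_neg_one_pow_card_quotient (π : Perm α) :
    sign π = (-1) ^ (Fintype.card α + Nat.card (Quotient (SameCycle.setoid π))) := by
  have hcard : (Finset.univ.image (cycleSet π)).card =
      Multiset.card π.cycleType + (Fintype.card α - π.support.card) := by
    -- Orbits are either supports of nontrivial cycles or singletons of fixed points.
    have hsplit : Finset.univ.image (cycleSet π) =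
        π.cycleFactorsFinset.image support ∪ π.supportᶜ.image (fun x => {x}) := by
      ext c
      simp only [Finset.mem_image, Finset.mem_univ, true_and, Finset.mem_union,
        Finset.mem_compl]
      constructor
      · rintro ⟨x, rfl⟩
        by_cases hx : x ∈ π.support
        · refine Or.inl ⟨π.cycleOf x, cycleOf_mem_cycleFactorsFinset_iff.2 hx, ?_⟩
          ext y
          rw [mem_cycleSet, mem_support_cycleOf_iff' (mem_support.1 hx)]
        · refine Or.inr ⟨x, hx, ?_⟩
          ext y
          rw [mem_cycleSet, Finset.mem_singleton]
          refine ⟨fun h => h ▸ SameCycle.refl _ _, fun h => ?_⟩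
          exact (SameCycle.eq_of_left h (notMem_support.1 hx)).symm
      · rintro (⟨c, hc, rfl⟩ | ⟨x, hx, rfl⟩)
        · obtain ⟨x, hx⟩ := (mem_cycleFactorsFinset_iff.1 hc).1.nonempty_support
          have hcx := cycle_is_cycleOf hx hc
          have hx' : π x ≠ x := mem_support.1 (mem_cycleFactorsFinset_support_le hc hx)
          refine ⟨x, ?_⟩
          ext y
          rw [mem_cycleSet, hcx, mem_support_cycleOf_iff' hx']
        · refine ⟨x, ?_⟩
          ext y
          rw [mem_cycleSet, Finset.mem_singleton]
          refine ⟨fun h => ?_, fun h => h ▸ SameCycle.refl _ _⟩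
          exact (SameCycle.eq_of_left h (notMem_support.1 hx)).symm
    rw [hsplit, Finset.card_union_of_disjoint, Finset.card_image_of_injOn,
      Finset.card_image_of_injective _ Finset.singleton_injective, Finset.card_compl,
      cycleType_def, Multiset.card_map]
    · rfl
    · intro c hc d hd hcd
      obtain ⟨x, hx⟩ := (mem_cycleFactorsFinset_iff.1 hc).1.nonempty_support
      have hx' : x ∈ d.support := by rw [← show c.support = d.support from hcd]; exact hx
      rw [cycle_is_cycleOf hx hc, cycle_is_cycleOf hx' hd]
    · rw [Finset.disjoint_left]
      simp only [Finset.mem_image, not_exists, not_and]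
      rintro _ ⟨c, hc, rfl⟩ x hx h
      have : x ∈ c.support := by rw [← h]; simp
      exact Finset.mem_compl.1 hx (mem_cycleFactorsFinset_support_le hc this)
  rw [card_quotient_eq_card_image (SameCycle.setoid π) (cycleSet π) fun x y => cycleSet_eq_iff,
    hcard, sign_of_cycleType, sum_cycleType]
  have hle : π.support.card ≤ Fintype.card α := Finset.card_le_univ _
  obtain ⟨d, hd⟩ := Nat.exists_eq_add_of_le hle
  rw [hd, Nat.add_sub_cancel_left, show π.support.card + d + (Multiset.card π.cycleType + d) =
    π.support.card + Multiset.card π.cycleType + 2 * d by ring, pow_add _ _ (2 * d), pow_mul]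
  simp

end

section

variable {α : Type*}

/-- The equivalence relation of lying in the same orbit of the group generated by `σ` and `g`. -/
def jointSetoid (σ g : Perm α) : Setoid α :=
  Relation.EqvGen.setoid fun x y => y = σ x ∨ y = g x

theorem jointSetoid_left (σ g : Perm α) (x : α) : jointSetoid σ g x (σ x) :=
  Relation.EqvGen.rel _ _ (Or.inl rfl)

theorem jointSetoid_right (σ g : Perm α) (x : α) : jointSetoid σ g x (g x) :=
  Relation.EqvGen.rel _ _ (Or.inr rfl)

theorem jointSetoid_le {σ g : Perm α} {s : Setoid α} (h₁ : ∀ x, s x (σ x)) (h₂ : ∀ x, s x (g x)) :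
    jointSetoid σ g ≤ s :=
  Setoid.eqvGen_le fun x y h => by
    rcases h with rfl | rfl
    exacts [h₁ x, h₂ x]

theorem setoid_zpow {s : Setoid α} {π : Perm α} (h : ∀ x, s x (π x)) (k : ℤ) (x : α) :
    s x ((π ^ k) x) := by
  induction k with
  | zero => exact s.refl _
  | succ k ih =>
    rw [add_comm, zpow_add, zpow_one, Perm.mul_apply]
    exact s.trans ih (h _)
  | pred k ih =>
    refine s.trans ih (s.symm ?_)
    have := h ((π ^ (-(k : ℤ) - 1)) x)
    rwa [← Perm.mul_apply, ← zpow_one_add, show 1 + (-(k : ℤ) - 1) = -k by ring] at this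

/-- The number of orbits of the group generated by `σ` and `g`. -/
def jointOrbits (σ g : Perm α) : ℕ := Nat.card (Quotient (jointSetoid σ g))

theorem jointOrbits_conj (σ g x : Perm α) :
    jointOrbits (x * σ * x⁻¹) (x * g * x⁻¹) = jointOrbits σ g := by
  symm
  have key : ∀ (σ g x : Perm α) (a b : α), jointSetoid σ g a b →
      jointSetoid (x * σ * x⁻¹) (x * g * x⁻¹) (x a) (x b) := by
    intro σ g x a b h
    refine jointSetoid_le (s := (jointSetoid (x * σ * x⁻¹) (x * g * x⁻¹)).comap x)
      (fun c => ?_) (fun c => ?_) h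
    · simpa [Setoid.comap_rel] using jointSetoid_left (x * σ * x⁻¹) (x * g * x⁻¹) (x c)
    · simpa [Setoid.comap_rel] using jointSetoid_right (x * σ * x⁻¹) (x * g * x⁻¹) (x c)
  refine card_quotient_congr _ _ x x.surjective fun a b => ⟨key σ g x a b, fun h => ?_⟩
  have h' := key _ _ x⁻¹ _ _ h
  rw [show x⁻¹ * (x * σ * x⁻¹) * x⁻¹⁻¹ = σ by group,
    show x⁻¹ * (x * g * x⁻¹) * x⁻¹⁻¹ = g by group] at h'
  simpa using h'

/-- As γ moves each point at most one step along g, it stays inside the g-orbits, so the equivalence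
relation generated does not change. The case used is γ a cycle of g. -/
theorem jointOrbits_mul {σ g γ : Perm α} (hγ : ∀ x, γ x = x ∨ γ x = g x) :
    jointOrbits (σ * γ) g = jointOrbits σ g := by
  have : jointSetoid (σ * γ) g = jointSetoid σ g := by
    have hJ : ∀ τ x, jointSetoid τ g x (γ x) := fun τ x => by
      rcases hγ x with h | h
      · rw [h]
      · rw [h]; exact jointSetoid_right _ _ _
    refine le_antisymm (jointSetoid_le (fun x => ?_) fun x => jointSetoid_right _ _ _)
      (jointSetoid_le (fun x => ?_) fun x => jointSetoid_right _ _ _)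
    · exact (jointSetoid σ g).trans (hJ σ x) (jointSetoid_left σ g (γ x))
    · have h1 := jointSetoid_left (σ * γ) g (γ⁻¹ x)
      have h2 := hJ (σ * γ) (γ⁻¹ x)
      rw [Perm.mul_apply, show γ (γ⁻¹ x) = x by simp] at h1
      rw [show γ (γ⁻¹ x) = x by simp] at h2
      exact (jointSetoid (σ * γ) g).trans ((jointSetoid (σ * γ) g).symm h2) h1
  rw [jointOrbits, this, jointOrbits]

end

/-! ### The twist in terms of orbit numbers -/

theorem smul_cycleSet {n : ℕ} {σ g : Perm (Fin n)} (hg : g * σ = σ * g) (x : Fin n) :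
    g • cycleSet σ x = cycleSet σ (g x) := by
  have hconj : g * σ * g⁻¹ = σ := by rw [hg, mul_inv_cancel_right]
  ext y
  rw [← Finset.inv_smul_mem_iff, mem_cycleSet, mem_cycleSet, Equiv.Perm.smul_def]
  conv_rhs => rw [← hconj, sameCycle_conj]
  simp

/-- By commutation g permutes the cycles of σ, so any word in σ and g can be reduced to a power of g
followed by motion within a cycle of σ. -/
theorem jointSetoid_iff {n : ℕ} {σ g : Perm (Fin n)} (hg : g * σ = σ * g) (x y : Fin n) :
    jointSetoid σ g x y ↔ ∃ k : ℤ, cycleSet σ ((g ^ k) x) = cycleSet σ y := by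
  have hpow : ∀ k : ℤ, g ^ k * σ = σ * g ^ k := fun k => (Commute.zpow_left hg k).eq
  constructor
  · intro h
    let s : Setoid (Fin n) :=
      { r := fun x y => ∃ k : ℤ, cycleSet σ ((g ^ k) x) = cycleSet σ y
        iseqv :=
          { refl := fun x => ⟨0, rfl⟩
            symm := by
              rintro x y ⟨k, hk⟩
              refine ⟨-k, ?_⟩
              rw [← smul_cycleSet (hpow _), ← hk, ← smul_cycleSet (hpow _), smul_smul, ← zpow_add]
              simp
            trans := by
              rintro x y z ⟨k, hk⟩ ⟨l, hl⟩
              refine ⟨l + k, ?_⟩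
              rw [zpow_add, Perm.mul_apply, ← hl, ← smul_cycleSet (hpow l), hk,
                smul_cycleSet (hpow l)] } }
    refine jointSetoid_le (s := s) (fun x => ⟨0, ?_⟩) (fun x => ⟨1, by simp⟩) h
    rw [cycleSet_eq_iff]
    exact ⟨1, by simp⟩
  · rintro ⟨k, hk⟩
    rw [cycleSet_eq_iff] at hk
    obtain ⟨l, rfl⟩ := hk
    exact (jointSetoid σ g).trans (setoid_zpow (jointSetoid_right σ g) k x)
      (setoid_zpow (jointSetoid_left σ g) l _)

theorem cycleAction_zpow_apply {n : ℕ} (σ : Perm (Fin n)) (g : Subgroup.centralizer {σ}) (i : ℕ)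
    (k : ℤ) (c : {c // c ∈ cyclesOfLength σ i}) :
    ((cycleAction σ i g ^ k) c : Finset (Fin n)) = (g : Perm (Fin n)) ^ k • (c : Finset (Fin n)) := by
  rw [← map_zpow]
  rfl

theorem mem_cyclesOfLength {n : ℕ} {σ : Perm (Fin n)} {i : ℕ} {c : Finset (Fin n)} :
    c ∈ cyclesOfLength σ i ↔ (∃ x, cycleSet σ x = c) ∧ c.card = i := by
  simp [cyclesOfLength, cycleSet]

theorem card_cycleSet_mem_Icc {n : ℕ} (σ : Perm (Fin n)) (x : Fin n) :
    (cycleSet σ x).card ∈ Finset.Icc 1 n := by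
  rw [Finset.mem_Icc, Nat.one_le_iff_ne_zero, Finset.card_ne_zero]
  exact ⟨⟨x, mem_cycleSet.2 (SameCycle.refl _ _)⟩, by simpa using Finset.card_le_univ (cycleSet σ x)⟩

theorem sum_card_cyclesOfLength {n : ℕ} (σ : Perm (Fin n)) :
    ∑ i ∈ Finset.Icc 1 n, Fintype.card {c // c ∈ cyclesOfLength σ i} =
      Nat.card (Quotient (SameCycle.setoid σ)) := by
  rw [card_quotient_eq_card_image (SameCycle.setoid σ) (cycleSet σ) fun x y => cycleSet_eq_iff,
    Finset.card_eq_sum_card_fiberwise (f := Finset.card) (t := Finset.Icc 1 n)]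
  · refine Finset.sum_congr rfl fun i _ => ?_
    rw [Fintype.card_coe]
    rfl
  · intro c hc
    obtain ⟨x, -, rfl⟩ := Finset.mem_image.1 hc
    exact card_cycleSet_mem_Icc σ x

/-- A joint orbit is a g-orbit of cycles of σ, and g preserves cycle length; the joint orbits are
therefore sorted by that common length. -/
theorem sum_card_quotient_cycleAction {n : ℕ} (σ : Perm (Fin n)) (g : Subgroup.centralizer {σ}) :
    ∑ i ∈ Finset.Icc 1 n, Nat.card (Quotient (SameCycle.setoid (cycleAction σ i g))) =
      jointOrbits σ g := by
  classical
  have hg : (g : Perm (Fin n)) * σ = σ * g := Subgroup.mem_centralizer_singleton_iff.1 g.2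
  have hpow : ∀ k : ℤ, (g : Perm (Fin n)) ^ k * σ = σ * (g : Perm (Fin n)) ^ k :=
    fun k => (Commute.zpow_left hg k).eq
  have hlen : ∀ x y, jointSetoid σ g x y → (cycleSet σ x).card = (cycleSet σ y).card := by
    intro x y h
    obtain ⟨k, hk⟩ := (jointSetoid_iff hg x y).1 h
    rw [← hk, ← smul_cycleSet (hpow k), Finset.card_smul_finset]
  let len : Quotient (jointSetoid σ g) → ℕ := Quotient.lift (fun x => (cycleSet σ x).card) hlen
  rw [jointOrbits, Nat.card_eq_fintype_card, ← Finset.card_univ,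
    Finset.card_eq_sum_card_fiberwise (f := len) (t := Finset.Icc 1 n)]
  · refine Finset.sum_congr rfl fun i _ => ?_
    rw [← Fintype.card_subtype, ← Nat.card_eq_fintype_card]
    have e := Equiv.subtypeQuotientEquivQuotientSubtype (s₁ := jointSetoid σ g)
      (s₂ := (jointSetoid σ g).comap Subtype.val) (fun x => (cycleSet σ x).card = i)
      (fun q => len q = i) (fun a => Iff.rfl) (fun _ _ => Iff.rfl)
    rw [Nat.card_congr e]
    symm
    refine card_quotient_congr _ _
      (fun x => ⟨cycleSet σ x.1, mem_cyclesOfLength.2 ⟨⟨x.1, rfl⟩, x.2⟩⟩) ?_ ?_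
    · rintro ⟨c, hc⟩
      obtain ⟨⟨x, rfl⟩, hx⟩ := mem_cyclesOfLength.1 hc
      exact ⟨⟨x, hx⟩, rfl⟩
    · rintro ⟨x, hx⟩ ⟨y, hy⟩
      refine (jointSetoid_iff hg x y).trans (exists_congr fun k => ?_)
      rw [Subtype.ext_iff, cycleAction_zpow_apply, smul_cycleSet (hpow k)]
  · rintro ⟨x⟩ -
    exact card_cycleSet_mem_Icc σ x

/-- The twist in terms of the sign of `σ` and the number of orbits of the group generated by `σ`
and `g`. -/
theorem twistSign_apply {n : ℕ} (σ : Perm (Fin n)) (g : Subgroup.centralizer {σ}) :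
    twistSign σ g = sign σ * (-1) ^ (n + jointOrbits σ g) := by
  have h : twistSign σ g = ∏ i ∈ Finset.Icc 1 n, sign (cycleAction σ i g) := by
    simp [twistSign, MonoidHom.finsetProd_apply]
  rw [h, Finset.prod_congr rfl fun i _ => sign_eq_neg_one_pow_card_quotient (cycleAction σ i g),
    Finset.prod_pow_eq_pow_sum, Finset.sum_add_distrib, sum_card_cyclesOfLength,
    sum_card_quotient_cycleAction, sign_eq_neg_one_pow_card_quotient σ, ← pow_add, Fintype.card_fin,
    show n + Nat.card (Quotient (SameCycle.setoid σ)) + (n + jointOrbits σ g) =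
      Nat.card (Quotient (SameCycle.setoid σ)) + jointOrbits σ g + 2 * n by ring,
    pow_add _ _ (2 * n), pow_mul]
  simp

/-! ### Sums over conjugacy classes -/

/-- Summing over all conjugates of `s` counts each element of the conjugacy class as often as the
order of the centraliser of `s`. -/
theorem sum_conj_eq_card_centralizer_smul {G M : Type*} [Group G] [Fintype G] [DecidableEq G]
    [AddCommMonoid M] [DecidableRel (IsConj (α := G))] (s : G) (F : G → M) :
    ∑ x, F (x⁻¹ * s * x) =
      Nat.card (Subgroup.centralizer {s}) • ∑ t with IsConj s t, F t := by
  rw [← Finset.sum_fiberwise_of_maps_to (s := Finset.univ) (t := Finset.univ.filter (IsConj s))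
    (g := fun x => x⁻¹ * s * x) (fun x _ => by
      rw [Finset.mem_filter]
      exact ⟨Finset.mem_univ _, isConj_iff.2 ⟨x⁻¹, by simp⟩⟩), Finset.smul_sum]
  refine Finset.sum_congr rfl fun t ht => ?_
  obtain ⟨y, hy⟩ := isConj_iff.1 (Finset.mem_filter.1 ht).2
  rw [Finset.sum_congr rfl fun x hx => by rw [(Finset.mem_filter.1 hx).2], Finset.sum_const]
  congr 1
  rw [← Fintype.card_subtype, ← Nat.card_eq_fintype_card]
  -- With t = y s y⁻¹, the fibre over t is the coset of the centraliser of s through y⁻¹.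
  refine Nat.card_congr ⟨fun x => ⟨x.1 * y, ?_⟩, fun z => ⟨z.1 * y⁻¹, ?_⟩, fun x => ?_, fun z => ?_⟩
  · rw [Subgroup.mem_centralizer_singleton_iff]
    have h := x.2.trans hy.symm
    calc x.1 * y * s = x.1 * (y * s * y⁻¹) * y := by group
      _ = s * (x.1 * y) := by rw [← h]; group
  · have := Subgroup.mem_centralizer_singleton_iff.1 z.2
    rw [← hy, mul_inv_rev, inv_inv]
    calc y * z.1⁻¹ * s * (z.1 * y⁻¹) = y * z.1⁻¹ * (s * z.1) * y⁻¹ := by group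
      _ = y * s * y⁻¹ := by rw [← this]; group
  · simp
  · simp

/-- The cycle type of a permutation of `Fin n`, as a partition of `n`. -/
def cycleShape {n : ℕ} (σ : Perm (Fin n)) : n.Partition :=
  ⟨σ.partition.parts, σ.partition.parts_pos, by rw [σ.partition.parts_sum, Fintype.card_fin]⟩

theorem cycleShape_rep {n : ℕ} (l : n.Partition) : cycleShape (rep l) = l :=
  Nat.Partition.ext (rep_hasType l)

theorem isConj_iff_cycleShape_eq {n : ℕ} {σ τ : Perm (Fin n)} :
    IsConj σ τ ↔ cycleShape σ = cycleShape τ := by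
  rw [partition_eq_of_isConj, Nat.Partition.ext_iff, Nat.Partition.ext_iff]
  rfl

theorem isConj_rep_iff {n : ℕ} {σ : Perm (Fin n)} {l : n.Partition} :
    IsConj (rep l) σ ↔ cycleShape σ = l := by
  rw [isConj_iff_cycleShape_eq, cycleShape_rep, eq_comm]

theorem cycleShape_conj {n : ℕ} (σ x : Perm (Fin n)) : cycleShape (x * σ * x⁻¹) = cycleShape σ :=
  (isConj_iff_cycleShape_eq.1 (isConj_iff.2 ⟨x, rfl⟩)).symm

theorem sum_conj_rep {n : ℕ} {M : Type*} [AddCommMonoid M] (l : n.Partition)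
    (F : Perm (Fin n) → M) :
    ∑ x, F (x⁻¹ * rep l * x) =
      Nat.card (Subgroup.centralizer {rep l}) • ∑ t with cycleShape t = l, F t := by
  classical
  rw [sum_conj_eq_card_centralizer_smul]
  simp only [isConj_rep_iff]

/-! ### Characters of induced linear representations -/

theorem character_linRep {G : Type} [Group G] (χ : G →* ℤˣ) (g : G) :
    (linRep χ).character g = ((χ g : ℤ) : ℂ) := by
  simp [Representation.character, linRep]

/-- The character of a representation induced from a subgroup, as a sum over the ambient group. -/
theorem character_ind_subtype {G : Type} [Group G] [Fintype G] [DecidableEq G] (H : Subgroup G)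
    [DecidablePred (· ∈ H)] {A : Type} [AddCommGroup A] [Module ℂ A] [FiniteDimensional ℂ A]
    (ρ : Representation ℂ H A) (g : G) :
    (Representation.ind H.subtype ρ).character g = (Nat.card H : ℂ)⁻¹ *
      ∑ x : G, if h : x * g * x⁻¹ ∈ H then ρ.character ⟨x * g * x⁻¹, h⟩ else 0 := by
  have : NeZero (Fintype.card H : ℂ) := ⟨Nat.cast_ne_zero.2 Fintype.card_ne_zero⟩
  rw [Representation.character_ind, Nat.card_eq_fintype_card]
  congr 1
  simp_rw [Fintype.card_subtype, Finset.natCast_card_filter, Finset.mul_sum]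
  rw [Finset.sum_comm]
  refine Finset.sum_congr rfl fun x _ => ?_
  have hiff : ∀ h : H, H.subtype h * x = x * g ↔ (h : G) = x * g * x⁻¹ := fun h => by
    rw [eq_mul_inv_iff_mul_eq]; rfl
  simp_rw [hiff, mul_ite, mul_one, mul_zero]
  split_ifs with hx
  · rw [Finset.sum_eq_single ⟨x * g * x⁻¹, hx⟩]
    · simp
    · intro h _ hne
      rw [if_neg fun he => hne (Subtype.ext he)]
    · simp
  · refine Finset.sum_eq_zero fun h _ => if_neg ?_
    intro he
    exact hx (he ▸ h.2)

instance finite_indV {G : Type} [Group G] [Finite G] (H : Subgroup G) {A : Type} [AddCommGroup A]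
    [Module ℂ A] [FiniteDimensional ℂ A] (ρ : Representation ℂ H A) :
    FiniteDimensional ℂ (Representation.IndV H.subtype ρ) := by
  have : Module.Finite ℂ (MonoidAlgebra ℂ G) :=
    Module.Finite.equiv (MonoidAlgebra.coeffLinearEquiv ℂ).symm
  infer_instance

/-! ### The character of the twisted conjugacy module -/

/-- The twist extended by zero to all pairs of permutations. -/
def twistValue {n : ℕ} (g σ : Perm (Fin n)) : ℂ :=
  if g * σ = σ * g then ((sign σ * (-1) ^ (n + jointOrbits σ g) : ℤˣ) : ℤ) else 0

theorem twistValue_conj {n : ℕ} (g σ x : Perm (Fin n)) :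
    twistValue (x * g * x⁻¹) (x * σ * x⁻¹) = twistValue g σ := by
  have hiff : x * g * x⁻¹ * (x * σ * x⁻¹) = x * σ * x⁻¹ * (x * g * x⁻¹) ↔ g * σ = σ * g := by
    rw [conj_mul, conj_mul, mul_left_inj, mul_right_inj]
  unfold twistValue
  simp only [hiff, jointOrbits_conj, Perm.sign_mul, Perm.sign_inv]
  rw [mul_right_comm (sign x), Int.units_mul_self, one_mul]

/-- The induced character averages the twist over conjugators x. Moving the conjugation from g to
`rep l` turns this into a sum over the class, each element occurring as often as the order of the
centraliser, which cancels the normalisation. -/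
theorem character_twistedClass {n : ℕ} (l : n.Partition) (g : Perm (Fin n)) :
    (twistedClass l).character g = ∑ σ with cycleShape σ = l, twistValue g σ := by
  classical
  rw [character_ind_subtype]
  have hsum : ∀ x : Perm (Fin n), (if h : x * g * x⁻¹ ∈ Subgroup.centralizer {rep l} then
      (linRep (twistSign (rep l))).character ⟨x * g * x⁻¹, h⟩ else 0) =
      twistValue g (x⁻¹ * rep l * x) := fun x => by
    rw [← twistValue_conj g _ x, show x * (x⁻¹ * rep l * x) * x⁻¹ = rep l by group, twistValue]
    by_cases h : x * g * x⁻¹ ∈ Subgroup.centralizer {rep l}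
    · rw [dif_pos h, if_pos (Subgroup.mem_centralizer_singleton_iff.1 h), character_linRep,
        twistSign_apply]
    · rw [dif_neg h, if_neg (fun h' => h (Subgroup.mem_centralizer_singleton_iff.2 h'))]
  rw [Finset.sum_congr rfl fun x _ => hsum x, sum_conj_rep, nsmul_eq_mul, ← mul_assoc,
    inv_mul_cancel₀ (Nat.cast_ne_zero.2 Nat.card_pos.ne'), one_mul]

theorem character_twistedConj_eq_sum {n : ℕ} (g : Perm (Fin n)) :
    (twistedConj n).character g = ∑ σ, twistValue g σ := by
  rw [Representation.character_directSum]
  rw [Finset.sum_congr rfl fun l _ => character_twistedClass l g]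
  exact Finset.sum_fiberwise Finset.univ cycleShape _

theorem mem_odds_iff {n : ℕ} {l : n.Partition} :
    l ∈ Nat.Partition.odds n ↔ ∀ i ∈ l.parts, ¬ Even i := by
  simp [Nat.Partition.odds, Nat.Partition.restricted]

theorem odd_orderOf {n : ℕ} {g : Perm (Fin n)} (hg : cycleShape g ∈ Nat.Partition.odds n) :
    Odd (orderOf g) := by
  rw [mem_odds_iff] at hg
  have hodd : ∀ i ∈ g.cycleType, ¬ 2 ∣ i := fun i hi h =>
    hg i (Multiset.mem_add.2 (Or.inl hi)) (even_iff_two_dvd.2 h)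
  have hdvd : orderOf g ∣ g.cycleType.prod := by
    rw [← lcm_cycleType]
    exact Multiset.lcm_dvd.2 fun b hb => Multiset.dvd_prod hb
  rw [← Nat.not_even_iff_odd, even_iff_two_dvd]
  intro h
  obtain ⟨i, hi, h2⟩ := Nat.prime_two.prime.exists_mem_multiset_dvd (h.trans hdvd)
  exact hodd i hi h2

/-- A homomorphism to {1, -1} is trivial on an element of odd order. -/
theorem twistValue_of_odd {n : ℕ} {g σ : Perm (Fin n)}
    (hg : cycleShape g ∈ Nat.Partition.odds n) (h : g * σ = σ * g) : twistValue g σ = 1 := by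
  let z : Subgroup.centralizer {σ} := ⟨g, Subgroup.mem_centralizer_singleton_iff.2 h⟩
  have hz : twistSign σ z ^ orderOf g = 1 := by
    rw [← map_pow, show z ^ orderOf g = 1 from Subtype.ext (pow_orderOf_eq_one g), map_one]
  have h1 : twistSign σ z = 1 := by
    rcases Int.units_eq_one_or (twistSign σ z) with h1 | h1
    · exact h1
    · rw [h1, (odd_orderOf hg).neg_one_pow] at hz
      exact absurd hz (by decide)
  rw [twistSign_apply] at h1
  rw [twistValue, if_pos h]
  rw [show (sign σ * (-1) ^ (n + jointOrbits σ g) : ℤˣ) = 1 from h1]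
  simp

/-- Right multiplication by an even-length cycle γ of g permutes the centraliser of g, preserves the
joint orbits and reverses the sign of σ; the sum thus equals its own negative. -/
theorem sum_twistValue_of_not_odd {n : ℕ} {g : Perm (Fin n)}
    (hg : cycleShape g ∉ Nat.Partition.odds n) : ∑ σ, twistValue g σ = 0 := by
  rw [mem_odds_iff] at hg
  push Not at hg
  obtain ⟨i, hi, heven⟩ := hg
  have hi' : i ∈ g.cycleType := by
    rcases Multiset.mem_add.1 (show i ∈ g.cycleType + _ from hi) with h | h
    · exact h
    · rw [Multiset.eq_of_mem_replicate h] at heven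
      exact absurd heven (by decide)
  rw [cycleType_def, Multiset.mem_map] at hi'
  obtain ⟨γ, hγ, hcard⟩ := hi'
  rw [Finset.mem_val] at hγ
  have hγ' := mem_cycleFactorsFinset_iff.1 hγ
  have hcomm : γ * g = g * γ := (self_mem_cycle_factors_commute hγ).eq
  have hsign : sign γ = -1 := by
    rw [hγ'.1.sign, show γ.support.card = i from hcard, heven.neg_one_pow]
  have hval : ∀ x, γ x = x ∨ γ x = g x := fun x => by
    by_cases hx : x ∈ γ.support
    · exact Or.inr (hγ'.2 x hx)
    · exact Or.inl (notMem_support.1 hx)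
  have hflip : ∀ σ, twistValue g (σ * γ) = -twistValue g σ := fun σ => by
    have hiff : g * (σ * γ) = σ * γ * g ↔ g * σ = σ * g := by
      rw [← mul_assoc, mul_assoc σ γ g, hcomm, ← mul_assoc, mul_left_inj]
    unfold twistValue
    simp only [hiff, jointOrbits_mul hval, Perm.sign_mul, hsign]
    split_ifs <;> simp
  have h := Fintype.sum_equiv (Equiv.mulRight γ) (fun σ => twistValue g (σ * γ)) (twistValue g)
    fun σ => rfl
  rw [Finset.sum_congr rfl fun σ _ => hflip σ, Finset.sum_neg_distrib] at h
  exact self_eq_neg.1 h.symm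

/-- The character of the twisted conjugacy module is the order of the centraliser on permutations
all of whose cycles have odd length, and vanishes elsewhere. -/
theorem character_twistedConj {n : ℕ} (g : Perm (Fin n)) :
    (twistedConj n).character g = if cycleShape g ∈ Nat.Partition.odds n then
      (Nat.card (Subgroup.centralizer {g}) : ℂ) else 0 := by
  classical
  rw [character_twistedConj_eq_sum]
  split_ifs with hg
  · have : ∀ σ, twistValue g σ = if g * σ = σ * g then 1 else 0 := fun σ => by
      split_ifs with h
      · exact twistValue_of_odd hg h
      · exact if_neg h
    rw [Finset.sum_congr rfl fun σ _ => this σ, ← Finset.natCast_card_filter, ← Fintype.card_subtype,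
      ← Nat.card_eq_fintype_card]
    congr 1
    refine Nat.card_congr (Equiv.subtypeEquivRight fun σ => ?_)
    rw [Subgroup.mem_centralizer_singleton_iff, eq_comm]
  · exact sum_twistValue_of_not_odd hg

theorem card_centralizer_congr {G : Type*} [Group G] {s t : G} (h : IsConj s t) :
    Nat.card (Subgroup.centralizer {s}) = Nat.card (Subgroup.centralizer {t}) := by
  obtain ⟨x, rfl⟩ := isConj_iff.1 h
  refine Nat.card_congr ((MulAut.conj x).toEquiv.subtypeEquiv fun z => ?_)
  simp only [Subgroup.mem_centralizer_singleton_iff]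
  change _ ↔ x * z * x⁻¹ * (x * s * x⁻¹) = x * s * x⁻¹ * (x * z * x⁻¹)
  rw [conj_mul, conj_mul, mul_left_inj, mul_right_inj]

/-- Pairing the character of the twisted conjugacy module with a class function. -/
theorem sum_character_twistedConj_smul {n : ℕ} {M : Type*} [AddCommGroup M] [Module ℂ M]
    (Φ : n.Partition → M) :
    (n.factorial : ℂ)⁻¹ • ∑ g : Perm (Fin n), (twistedConj n).character g • Φ (cycleShape g) =
      ∑ l ∈ Nat.Partition.odds n, Φ l := by
  rw [← Finset.sum_fiberwise Finset.univ cycleShape, Finset.smul_sum,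
    ← Finset.sum_subset (Finset.subset_univ (Nat.Partition.odds n))]
  · refine Finset.sum_congr rfl fun l hl => ?_
    have hterm : ∀ g ∈ Finset.univ.filter fun g : Perm (Fin n) => cycleShape g = l,
        (twistedConj n).character g • Φ (cycleShape g) =
          (Nat.card (Subgroup.centralizer {rep l}) : ℂ) • Φ l := fun g hg => by
      have hg := (Finset.mem_filter.1 hg).2
      rw [character_twistedConj, hg, if_pos hl, card_centralizer_congr (isConj_rep_iff.2 hg)]
    rw [Finset.sum_congr rfl hterm, Finset.sum_const, ← Nat.cast_smul_eq_nsmul ℂ, smul_smul,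
      smul_smul]
    -- Orbit-stabiliser: class size times centraliser order is n!.
    have hcount := sum_conj_rep l fun _ => (1 : ℂ)
    simp only [Finset.sum_const, nsmul_eq_mul, mul_one, Finset.card_univ, Fintype.card_perm,
      Fintype.card_fin] at hcount
    rw [mul_assoc, mul_comm (Nat.cast (Finset.card _)), ← hcount,
      inv_mul_cancel₀ (Nat.cast_ne_zero.2 n.factorial_ne_zero), one_smul]
  · intro l _ hl
    rw [Finset.sum_eq_zero, smul_zero]
    intro g hg
    rw [character_twistedConj, (Finset.mem_filter.1 hg).2, if_neg hl, zero_smul]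

/-! ### Frobenius characteristic, degree, self-conjugacy and multiplicities -/

theorem frob_twistedConj (n : ℕ) :
    frob (twistedConj n) = ∑ l ∈ Nat.Partition.odds n, pPart l :=
  sum_character_twistedConj_smul fun l => pPart l

instance finiteDimensional_twistedSpace (n : ℕ) : FiniteDimensional ℂ (TwistedSpace n) :=
  Module.Finite.equiv (DirectSum.linearEquivFunOnFintype ℂ n.Partition _).symm

theorem finrank_twistedSpace (n : ℕ) : Module.finrank ℂ (TwistedSpace n) = n.factorial := by
  have h := (twistedConj n).char_one
  have hodd : cycleShape (1 : Perm (Fin n)) ∈ Nat.Partition.odds n := by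
    rw [mem_odds_iff]
    intro i hi
    have hi : i ∈ (1 : Perm (Fin n)).cycleType + Multiset.replicate _ 1 := hi
    rw [cycleType_one, zero_add] at hi
    rw [Multiset.eq_of_mem_replicate hi]
    decide
  rw [character_twistedConj, if_pos hodd] at h
  have htop : Subgroup.centralizer {(1 : Perm (Fin n))} = ⊤ := by
    ext z; simp [Subgroup.mem_centralizer_singleton_iff]
  rw [htop, Subgroup.card_top, Nat.card_eq_fintype_card, Fintype.card_perm, Fintype.card_fin] at h
  exact_mod_cast h.symm

/-- The character is supported on permutations of odd order, where the sign is 1. -/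
theorem nonempty_twistedConj_tprod_sgnRep_equiv (n : ℕ) :
    Nonempty (((twistedConj n).tprod (sgnRep n)).Equiv (twistedConj n)) := by
  refine Representation.nonempty_equiv_of_character_eq _ _ (funext fun g => ?_)
  rw [Representation.char_tensor, Pi.mul_apply, character_linRep, character_twistedConj]
  split_ifs with hg
  · have hs : sign g = 1 := by
      rcases Int.units_eq_one_or (sign g) with h1 | h1
      · exact h1
      · have h2 : sign g ^ orderOf g = 1 := by rw [← map_pow, pow_orderOf_eq_one, map_one]
        rw [h1, (odd_orderOf hg).neg_one_pow] at h2
        exact absurd h2 (by decide)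
    simp [hs]
  · simp

theorem cycleShape_inv {n : ℕ} (g : Perm (Fin n)) : cycleShape g⁻¹ = cycleShape g :=
  isConj_iff_cycleShape_eq.1 (isConj_iff_cycleType_eq.2 (cycleType_inv g))

/-- The sum is the pairing of the two characters, hence the dimension of the space of intertwiners
from the Specht module to ε(S_n). -/
theorem sum_irrChar_odds {n : ℕ} (ν : n.Partition) :
    ∃ k : ℕ, ∑ l ∈ Nat.Partition.odds n, irrChar ν l = (k : ℂ) := by
  have : Module.Finite ℂ (MonoidAlgebra ℂ (Perm (Fin n))) :=
    Module.Finite.equiv (MonoidAlgebra.coeffLinearEquiv ℂ).symm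
  have : FiniteDimensional ℂ
      ↥(Ideal.span {youngSymmetrizer ν} : Ideal (MonoidAlgebra ℂ (Perm (Fin n)))) :=
    inferInstanceAs (Module.Finite ℂ (Submodule.restrictScalars ℂ
      (Ideal.span {youngSymmetrizer ν} : Ideal (MonoidAlgebra ℂ (Perm (Fin n))))))
  have : Invertible (Nat.card (Perm (Fin n)) : ℂ) :=
    invertibleOfNonzero (Nat.cast_ne_zero.2 Nat.card_pos.ne')
  refine ⟨_, Eq.trans ?_ (Representation.card_inv_mul_sum_char_mul_char_eq_finrank
    (specht ν) (twistedConj n))⟩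
  rw [← sum_character_twistedConj_smul, Nat.card_eq_fintype_card, Fintype.card_perm,
    Fintype.card_fin, smul_eq_mul]
  congr 1
  refine Finset.sum_congr rfl fun g _ => ?_
  rw [smul_eq_mul]
  congr 1
  -- The pairing evaluates one character at g⁻¹, which is conjugate to g in a symmetric group.
  obtain ⟨x, hx⟩ := isConj_iff.1 (isConj_rep_iff.2 (cycleShape_inv g))
  rw [irrChar, ← hx, Representation.char_conj]

end TwistedConj

namespace TwistedConj

/-! ### Restricting symmetric functions to finitely many variables -/

/-- A surjective endomorphism of a Noetherian ring is injective. -/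
theorem injective_of_surjective_ringHom {R : Type*} [CommRing R] [IsNoetherianRing R] (f : R →+* R)
    (hf : Function.Surjective f) : Function.Injective f := by
  -- The kernels of the iterates stabilise at some n; an element of the kernel of f, written as
  -- fⁿ(y), then has y in the kernel of fⁿ⁺¹, so of fⁿ.
  let I : ℕ →o Ideal R :=
    ⟨fun n => RingHom.ker (f ^ n), monotone_nat_of_le_succ fun n x hx => by
      rw [RingHom.mem_ker] at hx ⊢
      rw [pow_succ', RingHom.mul_def, RingHom.comp_apply, hx, map_zero]⟩
  obtain ⟨n, hn⟩ := monotone_stabilizes_iff_noetherian.2 ‹IsNoetherianRing R› I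
  have hsurj : Function.Surjective (f ^ n) := by
    rw [RingHom.coe_pow]; exact hf.iterate n
  rw [injective_iff_map_eq_zero]
  intro x hx
  obtain ⟨y, rfl⟩ := hsurj x
  have hy : y ∈ I (n + 1) := by
    change y ∈ RingHom.ker (f ^ (n + 1))
    rw [RingHom.mem_ker, pow_succ', RingHom.mul_def, RingHom.comp_apply, hx]
  rw [← hn (n + 1) n.le_succ] at hy
  exact RingHom.mem_ker.1 hy

/-- Setting all but the first `N` variables to zero. -/
abbrev restrictVars (N : ℕ) : MvPowerSeries ℕ ℂ →ₐ[ℂ] MvPowerSeries (Fin N) ℂ :=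
  MvPowerSeries.killCompl Fin.valEmbedding

/-- A monomial involves finitely many variables. This transfers identities of symmetric polynomials
to infinitely many variables. -/
theorem eq_of_restrictVars_eq {f g : MvPowerSeries ℕ ℂ}
    (h : ∀ N, restrictVars N f = restrictVars N g) : f = g := by
  ext m
  obtain ⟨N, hN⟩ : ∃ N, ∀ i ∈ m.support, i < N :=
    ⟨m.support.sup id + 1, fun i hi => Nat.lt_succ_of_le (Finset.le_sup (f := id) hi)⟩
  obtain ⟨x, rfl⟩ : ∃ x : Fin N →₀ ℕ, m = x.embDomain Fin.valEmbedding := by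
    refine ⟨m.comapDomain Fin.valEmbedding Fin.val_injective.injOn, ?_⟩
    rw [Finsupp.embDomain_comapDomain]
    intro i hi
    exact ⟨⟨i, hN i hi⟩, rfl⟩
  have := congrArg (MvPowerSeries.coeff x) (h N)
  rwa [MvPowerSeries.coeff_killCompl, MvPowerSeries.coeff_killCompl] at this

theorem coeff_pSym (k : ℕ) (m : ℕ →₀ ℕ) [Decidable (∃ i, m = Finsupp.single i k)] :
    MvPowerSeries.coeff m (pSym k) = if ∃ i, m = Finsupp.single i k then 1 else 0 := by
  rw [MvPowerSeries.coeff_apply, pSym]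
  congr

theorem coeff_eSym (k : ℕ) (m : ℕ →₀ ℕ) [Decidable ((∀ i, m i ≤ 1) ∧ m.degree = k)] :
    MvPowerSeries.coeff m (eSym k) = if (∀ i, m i ≤ 1) ∧ m.degree = k then 1 else 0 := by
  rw [MvPowerSeries.coeff_apply, eSym]
  congr

/-- The exponent 0 is excluded because `pSym 0` is 1 whereas the zeroth power sum in N variables is
N. -/
theorem restrictVars_pSym (N : ℕ) {k : ℕ} (hk : k ≠ 0) :
    restrictVars N (pSym k) = (MvPolynomial.psum (Fin N) ℂ k : MvPowerSeries (Fin N) ℂ) := by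
  classical
  ext x
  rw [MvPowerSeries.coeff_killCompl, coeff_pSym, MvPolynomial.coeff_coe, MvPolynomial.psum,
    MvPolynomial.coeff_sum]
  simp_rw [MvPolynomial.coeff_X_pow]
  have hiff : (∃ i, x.embDomain Fin.valEmbedding = Finsupp.single i k) ↔
      ∃ j, Finsupp.single j k = x := by
    constructor
    · rintro ⟨i, hi⟩
      have hmem : i ∈ (x.embDomain Fin.valEmbedding).support := by
        rw [hi, Finsupp.mem_support_iff, Finsupp.single_eq_same]; exact hk
      rw [Finsupp.support_embDomain, Finset.mem_map] at hmem
      obtain ⟨j, -, rfl⟩ := hmem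
      refine ⟨j, Finsupp.embDomain_injective Fin.valEmbedding ?_⟩
      rw [hi, Finsupp.embDomain_single]
    · rintro ⟨j, rfl⟩
      exact ⟨j, Finsupp.embDomain_single _ _ _⟩
  rw [if_congr hiff rfl rfl]
  split_ifs with h
  · obtain ⟨j, rfl⟩ := h
    rw [Finset.sum_eq_single j]
    · simp
    · intro i _ hij
      rw [if_neg]
      intro h
      exact hij ((Finsupp.single_left_inj hk).1 h)
    · simp
  · push Not at h
    rw [Finset.sum_eq_zero fun j _ => if_neg (h j)]

theorem restrictVars_eSym (N k : ℕ) :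
    restrictVars N (eSym k) = (MvPolynomial.esymm (Fin N) ℂ k : MvPowerSeries (Fin N) ℂ) := by
  classical
  ext x
  rw [MvPowerSeries.coeff_killCompl, coeff_eSym, MvPolynomial.coeff_coe,
    MvPolynomial.esymm_eq_sum_monomial, MvPolynomial.coeff_sum]
  simp_rw [MvPolynomial.coeff_monomial]
  have hval : ∀ (t : Finset (Fin N)) (i : Fin N),
      (∑ j ∈ t, Finsupp.single j 1 : Fin N →₀ ℕ) i = if i ∈ t then 1 else 0 := fun t i => by
    simp [Finsupp.finsetSum_apply, Finsupp.single_apply]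
  have hdeg : (x.embDomain Fin.valEmbedding).degree = ∑ i, x i := by
    rw [Finsupp.degree_apply, Finsupp.support_embDomain, Finset.sum_map,
      ← Finset.sum_subset (Finset.subset_univ x.support)]
    · exact Finset.sum_congr rfl fun i _ => Finsupp.embDomain_apply_self _ _ _
    · intro i _ hi
      exact Finsupp.notMem_support_iff.1 hi
  have hle : (∀ i, x.embDomain Fin.valEmbedding i ≤ 1) ↔ ∀ i, x i ≤ 1 := by
    refine ⟨fun h i => ?_, fun h i => ?_⟩
    · rw [← Finsupp.embDomain_apply_self Fin.valEmbedding x i]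
      exact h _
    · by_cases hi : i ∈ Set.range (Fin.valEmbedding : Fin N ↪ ℕ)
      · obtain ⟨j, rfl⟩ := hi
        rw [Finsupp.embDomain_apply_self]
        exact h j
      · rw [Finsupp.embDomain_of_notMem_range _ _ _ hi]; exact zero_le_one
  rw [hdeg, hle]
  have hx : (∀ i, x i ≤ 1) → ∀ i, x i = if i ∈ x.support then 1 else 0 := fun h i => by
    have := h i
    split_ifs with hi
    · have := Finsupp.mem_support_iff.1 hi; omega
    · exact Finsupp.notMem_support_iff.1 hi
  split_ifs with h
  · rw [Finset.sum_eq_single x.support]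
    · rw [if_pos]
      ext i
      rw [hval, hx h.1 i]
    · intro t _ ht
      rw [if_neg]
      rintro rfl
      apply ht
      ext i
      rw [Finsupp.mem_support_iff, hval]
      simp
    · intro hmem
      exfalso
      apply hmem
      rw [Finset.mem_powersetCard_univ, ← h.2, Finset.sum_congr rfl fun i _ => hx h.1 i,
        Finset.sum_ite_mem, Finset.univ_inter, Finset.sum_const, smul_eq_mul, mul_one]
  · symm
    refine Finset.sum_eq_zero fun t ht => if_neg ?_
    rintro rfl
    refine h ⟨fun i => ?_, ?_⟩
    · rw [hval]; split_ifs <;> simp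
    · simp_rw [hval]
      simpa using (Finset.mem_powersetCard_univ.1 ht)

/-! ### Newton's identities and the algebraic independence of the power sums -/

theorem newton_esymm (σ : Type*) [Fintype σ] (R : Type*) [CommRing R] (k : ℕ) :
    k * MvPolynomial.esymm σ R k = ∑ j ∈ Finset.range k,
      (-1) ^ j * MvPolynomial.psum σ R (j + 1) * MvPolynomial.esymm σ R (k - 1 - j) := by
  rw [MvPolynomial.mul_esymm_eq_sum, Finset.mul_sum]
  refine Finset.sum_bij' (fun a _ => a.2 - 1) (fun j _ => (k - 1 - j, j + 1)) ?_ ?_ ?_ ?_ ?_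
  · rintro ⟨a, b⟩ h
    simp only [Finset.mem_filter, Finset.HasAntidiagonal.mem_antidiagonal, Finset.mem_range] at h ⊢
    omega
  · intro j h
    simp only [Finset.mem_filter, Finset.HasAntidiagonal.mem_antidiagonal, Finset.mem_range] at h ⊢
    omega
  · rintro ⟨a, b⟩ h
    simp only [Finset.mem_filter, Finset.HasAntidiagonal.mem_antidiagonal, Prod.mk.injEq] at h ⊢
    omega
  · intro j h
    simp
  · rintro ⟨a, b⟩ h
    simp only [Finset.mem_filter, Finset.HasAntidiagonal.mem_antidiagonal] at h ⊢
    obtain ⟨rfl, hab⟩ := h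
    obtain ⟨c, rfl⟩ : ∃ c, b = c + 1 := ⟨b - 1, by omega⟩
    rw [show a + (c + 1) - 1 - (c + 1 - 1) = a by omega, Nat.add_sub_cancel,
      show a + (c + 1) + 1 = a + c + 2 by ring]
    have : (-1 : MvPolynomial σ R) ^ (a + c + 2) * (-1) ^ a = (-1) ^ c := by
      rw [← pow_add, show a + c + 2 + a = c + 2 * (a + 1) by ring, pow_add, pow_mul]; simp
    rw [← this]; ring

theorem newton_eSym (k : ℕ) :
    k * eSym k = ∑ j ∈ Finset.range k, (-1) ^ j * pSym (j + 1) * eSym (k - 1 - j) := by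
  refine eq_of_restrictVars_eq fun N => ?_
  have h := congrArg (MvPolynomial.coeToMvPowerSeries.ringHom (R := ℂ)) (newton_esymm (Fin N) ℂ k)
  simp only [map_mul, map_natCast, map_sum, map_pow, map_neg, map_one,
    MvPolynomial.coeToMvPowerSeries.ringHom_apply] at h ⊢
  simp only [restrictVars_eSym, restrictVars_pSym N (Nat.succ_ne_zero _)]
  exact h

theorem eSym_zero : eSym 0 = 1 := by
  refine eq_of_restrictVars_eq fun N => ?_
  rw [restrictVars_eSym, MvPolynomial.esymm_zero, map_one, MvPolynomial.coe_one]

/-- In characteristic zero one may divide by k in Newton's identity, so each e_k is a polynomial in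
p_1, …, p_k. -/
theorem mem_of_newton {A : Type*} [CommRing A] [Algebra ℂ A] (S : Subalgebra ℂ A) (e p : ℕ → A)
    (h0 : e 0 = 1)
    (h : ∀ k : ℕ, k * e k = ∑ j ∈ Finset.range k, (-1) ^ j * p (j + 1) * e (k - 1 - j))
    (N : ℕ) (hp : ∀ j < N, p (j + 1) ∈ S) : ∀ k ≤ N, e k ∈ S := by
  intro k
  induction k using Nat.strong_induction_on with
  | _ k ih =>
    intro hk
    rcases Nat.eq_zero_or_pos k with rfl | hpos
    · rw [h0]; exact S.one_mem
    have hmem : (k : A) * e k ∈ S := by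
      rw [h k]
      refine S.sum_mem fun j hj => S.mul_mem (S.mul_mem ?_ (hp j ?_)) (ih _ ?_ ?_)
      · exact S.pow_mem (S.neg_mem S.one_mem) _
      all_goals rw [Finset.mem_range] at hj; omega
    have : e k = (k : ℂ)⁻¹ • ((k : A) * e k) := by
      rw [← nsmul_eq_mul, ← Nat.cast_smul_eq_nsmul ℂ, smul_smul,
        inv_mul_cancel₀ (Nat.cast_ne_zero.2 hpos.ne'), one_smul]
    rw [this]
    exact S.smul_mem hmem _

/-- Write p_j = E(q_j), where E is the injective substitution of the elementary symmetric
polynomials. By Newton, X_j ↦ q_j is surjective, hence injective since the polynomial ring is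
Noetherian; the map in question is its composite with E. -/
theorem psum_injective (N : ℕ) : Function.Injective
    (MvPolynomial.aeval fun j : Fin N => MvPolynomial.psum (Fin N) ℂ (j + 1) :
      MvPolynomial (Fin N) ℂ →ₐ[ℂ] MvPolynomial (Fin N) ℂ) := by
  set E : MvPolynomial (Fin N) ℂ →ₐ[ℂ] MvPolynomial (Fin N) ℂ :=
    MvPolynomial.aeval fun j : Fin N => MvPolynomial.esymm (Fin N) ℂ (j + 1) with hE
  set Φ : MvPolynomial (Fin N) ℂ →ₐ[ℂ] MvPolynomial (Fin N) ℂ :=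
    MvPolynomial.aeval fun j : Fin N => MvPolynomial.psum (Fin N) ℂ (j + 1) with hΦ
  have hEinj : Function.Injective E := fun a b hab =>
    MvPolynomial.esymmAlgHom_injective (σ := Fin N) (n := N) ℂ (by simp)
      (Subtype.ext (by rw [MvPolynomial.esymmAlgHom_apply, MvPolynomial.esymmAlgHom_apply]; exact hab))
  have hq : ∀ j : Fin N, ∃ q, E q = MvPolynomial.psum (Fin N) ℂ (j + 1) := fun j => by
    obtain ⟨q, hq⟩ := MvPolynomial.esymmAlgHom_surjective (σ := Fin N) (n := N) ℂ (by simp)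
      ⟨_, MvPolynomial.psum_isSymmetric (Fin N) ℂ (j + 1)⟩
    refine ⟨q, ?_⟩
    rw [hE, ← MvPolynomial.esymmAlgHom_apply, hq]
  choose q hq using hq
  have hcomp : E.comp (MvPolynomial.aeval q) = Φ := by
    refine MvPolynomial.algHom_ext fun j => ?_
    simp [hq, hΦ]
  have hsurj : Function.Surjective (MvPolynomial.aeval q : MvPolynomial (Fin N) ℂ →ₐ[ℂ] _) := by
    rw [← AlgHom.range_eq_top, eq_top_iff, ← MvPolynomial.adjoin_range_X, Algebra.adjoin_le_iff]
    rintro _ ⟨i, rfl⟩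
    have hmem := mem_of_newton Φ.range (MvPolynomial.esymm (Fin N) ℂ) (MvPolynomial.psum (Fin N) ℂ)
      (MvPolynomial.esymm_zero _ _) (newton_esymm _ _) N
      (fun j hj => ⟨MvPolynomial.X ⟨j, hj⟩, by simp [hΦ]⟩) (i + 1) i.2
    obtain ⟨r, hr⟩ := hmem
    refine ⟨r, hEinj ?_⟩
    have : E (MvPolynomial.aeval q r) = Φ r := by rw [← hcomp]; rfl
    refine this.trans (hr.trans ?_)
    simp [hE]
  have hinj := injective_of_surjective_ringHom
    (MvPolynomial.aeval q : MvPolynomial (Fin N) ℂ →ₐ[ℂ] _).toRingHom hsurj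
  rw [← hcomp]
  exact hEinj.comp hinj

/-- The power sums are algebraically independent. -/
theorem pSym_injective : Function.Injective
    (MvPolynomial.aeval fun k : ℕ+ => pSym k : MvPolynomial ℕ+ ℂ →ₐ[ℂ] MvPowerSeries ℕ ℂ) := by
  rw [injective_iff_map_eq_zero]
  intro P hP
  -- A relation involves only p_1, …, p_N for some N, and these stay independent in N variables.
  obtain ⟨N, hN⟩ : ∃ N, ∀ i ∈ P.vars, (i : ℕ) ≤ N :=
    ⟨P.vars.sup (fun i => (i : ℕ)), fun i hi => Finset.le_sup (f := fun i : ℕ+ => (i : ℕ)) hi⟩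
  obtain ⟨Q, rfl⟩ := MvPolynomial.exists_rename_eq_of_vars_subset_range P
    (fun j : Fin N => Nat.succPNat j) (fun a b h => Fin.ext (Nat.succPNat_injective h))
    (fun i hi => ⟨⟨i.natPred, by
      have := hN i hi
      have := i.natPred_add_one
      omega⟩, by simp⟩)
  have h := congrArg (restrictVars N) hP
  rw [MvPolynomial.aeval_rename, map_zero] at h
  have hcomp : (restrictVars N).comp
      (MvPolynomial.aeval ((fun k : ℕ+ => pSym k) ∘ fun j : Fin N => Nat.succPNat j)) =
      (MvPolynomial.coeToMvPowerSeries.algHom ℂ).comp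
        (MvPolynomial.aeval fun j : Fin N => MvPolynomial.psum (Fin N) ℂ (j + 1)) := by
    refine MvPolynomial.algHom_ext fun j => ?_
    simp [restrictVars_pSym]
  have h' := (DFunLike.congr_fun hcomp Q).symm.trans h
  have h0 : MvPolynomial.aeval (fun j : Fin N => MvPolynomial.psum (Fin N) ℂ (j + 1)) Q = 0 := by
    refine MvPolynomial.coe_injective (σ := Fin N) (R := ℂ) ?_
    simpa using h'
  rw [(injective_iff_map_eq_zero _).1 (psum_injective N) Q h0, map_zero]

/-! ### Plethysm of elementary symmetric functions -/

theorem exists_aeval_eq_eSym (k : ℕ) :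
    ∃ P : MvPolynomial ℕ+ ℂ, MvPolynomial.aeval (fun k : ℕ+ => pSym k) P = eSym k :=
  mem_of_newton (MvPolynomial.aeval (fun k : ℕ+ => pSym k) :
    MvPolynomial ℕ+ ℂ →ₐ[ℂ] MvPowerSeries ℕ ℂ).range eSym pSym eSym_zero newton_eSym k
    (fun j _ => ⟨MvPolynomial.X (Nat.succPNat j), by simp⟩) k le_rfl

/-- Algebraic independence makes the polynomial chosen in `plethysm` unique. -/
theorem plethysm_aeval (P : MvPolynomial ℕ+ ℂ) (g : MvPowerSeries ℕ ℂ) :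
    plethysm (MvPolynomial.aeval (fun k : ℕ+ => pSym k) P) g =
      MvPolynomial.aeval (fun k : ℕ+ => MvPowerSeries.expand (k : ℕ) k.ne_zero g) P := by
  have h : ∃ P' : MvPolynomial ℕ+ ℂ, MvPolynomial.aeval (fun k : ℕ+ => pSym k) P' =
      MvPolynomial.aeval (fun k : ℕ+ => pSym k) P := ⟨P, rfl⟩
  rw [plethysm, dif_pos h, pSym_injective h.choose_spec]

theorem plethysm_eSym_zero (g : MvPowerSeries ℕ ℂ) : plethysm (eSym 0) g = 1 := by
  have h := plethysm_aeval 1 g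
  rw [map_one, map_one] at h
  rw [eSym_zero, h]

/-- Newton's identities for the plethysms `e_k[g]`. -/
theorem newton_plethysm (g : MvPowerSeries ℕ ℂ) (k : ℕ) :
    k * plethysm (eSym k) g = ∑ j ∈ Finset.range k, (-1) ^ j *
      MvPowerSeries.expand (j + 1) j.succ_ne_zero g * plethysm (eSym (k - 1 - j)) g := by
  choose P hP using exists_aeval_eq_eSym
  -- Newton's identity is lifted to the polynomial ring, where the other evaluation p_k ↦ p_k[g] can
  -- be applied.
  have hN : k * P k = ∑ j ∈ Finset.range k,
      (-1) ^ j * MvPolynomial.X (Nat.succPNat j) * P (k - 1 - j) := by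
    apply pSym_injective
    simp only [map_mul, map_natCast, map_sum, map_pow, map_neg, map_one, hP, MvPolynomial.aeval_X]
    exact newton_eSym k
  have h := congrArg
    (MvPolynomial.aeval (fun k : ℕ+ => MvPowerSeries.expand (k : ℕ) k.ne_zero g)) hN
  simp only [map_mul, map_natCast, map_sum, map_pow, map_neg, map_one, MvPolynomial.aeval_X,
    ← plethysm_aeval, hP] at h
  exact h

theorem expand_pSym (k : ℕ) (hk : k ≠ 0) (d : ℕ) :
    MvPowerSeries.expand k hk (pSym d) = pSym (k * d) := by
  classical
  ext m
  by_cases h : ∃ m', m = k • m'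
  · obtain ⟨m, rfl⟩ := h
    rw [MvPowerSeries.coeff_expand_smul, coeff_pSym, coeff_pSym]
    refine if_congr (exists_congr fun i => ?_) rfl rfl
    rw [← smul_eq_mul, ← Finsupp.smul_single]
    exact (nsmul_right_inj hk).symm
  · obtain ⟨i, hi⟩ : ∃ i, ¬ k ∣ m i := by
      by_contra! hdvd
      refine h ⟨m.mapRange (fun a => a / k) (Nat.zero_div k), Finsupp.ext fun i => ?_⟩
      exact (Nat.mul_div_cancel' (hdvd i)).symm
    rw [MvPowerSeries.coeff_expand_of_not_dvd k hk _ hi, coeff_pSym, if_neg]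
    rintro ⟨j, rfl⟩
    exact h ⟨Finsupp.single j d, by rw [Finsupp.smul_single, smul_eq_mul]⟩

end TwistedConj

namespace TwistedConj

open Equiv Equiv.Perm

/-! ### The Frobenius characteristic of `1↑_{C_n}^{S_n}` -/

/-- The Frobenius characteristic of an induced trivial representation is the cycle index. -/
theorem frob_ind_trivial {n : ℕ} (H : Subgroup (Perm (Fin n))) [DecidablePred (· ∈ H)] :
    frob (Representation.ind H.subtype (Representation.trivial ℂ H ℂ)) =
      (Nat.card H : ℂ)⁻¹ • ∑ h : H, pPart (cycleShape (h : Perm (Fin n))) := by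
  have hchar : ∀ g, (Representation.ind H.subtype (Representation.trivial ℂ H ℂ)).character g =
      (Nat.card H : ℂ)⁻¹ * ∑ x : Perm (Fin n), if x * g * x⁻¹ ∈ H then 1 else 0 := fun g => by
    rw [character_ind_subtype]
    congr 1
    refine Finset.sum_congr rfl fun x _ => ?_
    split_ifs with h
    · simp [Representation.character]
    · rfl
  have hconj : ∀ x : Perm (Fin n),
      ∑ g : Perm (Fin n), (if x * g * x⁻¹ ∈ H then (1 : ℂ) else 0) • pPart (cycleShape g) =
        ∑ h : H, pPart (cycleShape (h : Perm (Fin n))) := fun x => by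
    rw [Fintype.sum_equiv (MulAut.conj x).toEquiv _
      (fun g => (if g ∈ H then (1 : ℂ) else 0) • pPart (cycleShape g)) fun g => by
        change _ = (if x * g * x⁻¹ ∈ H then (1 : ℂ) else 0) • pPart (cycleShape (x * g * x⁻¹))
        rw [cycleShape_conj]]
    simp_rw [ite_smul, one_smul, zero_smul]
    rw [← Finset.sum_filter]
    exact Finset.sum_subtype _ (by simp) _
  change (n.factorial : ℂ)⁻¹ • ∑ g : Perm (Fin n), _ • pPart (cycleShape g) = _
  simp_rw [hchar, mul_smul, Finset.sum_smul, ← Finset.smul_sum]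
  rw [Finset.sum_comm, Finset.sum_congr rfl fun x _ => hconj x, Finset.sum_const, Finset.card_univ,
    Fintype.card_perm, Fintype.card_fin, smul_comm, ← Nat.cast_smul_eq_nsmul ℂ, smul_smul _ _ (∑ h : H, _),
    inv_mul_cancel₀ (Nat.cast_ne_zero.2 n.factorial_ne_zero), one_smul]

theorem finRotate_pow_apply_val (m k : ℕ) (x : Fin (m + 1)) :
    ((finRotate (m + 1) ^ k) x : ℕ) = (x + k) % (m + 1) := by
  induction k with
  | zero => simp [Nat.mod_eq_of_lt x.2]
  | succ k ih =>
    rw [pow_succ', Perm.mul_apply, finRotate_apply, Fin.val_add, ih, Fin.val_one', ← Nat.add_mod,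
      add_assoc]

/-- The group generated by the rotation acts freely: adding k modulo m + 1 fixes a point only if m +
1 divides k. -/
theorem eq_one_of_mem_zpowers_finRotate {m : ℕ} {h : Perm (Fin (m + 1))}
    (hh : h ∈ Subgroup.zpowers (finRotate (m + 1))) {x : Fin (m + 1)} (hx : h x = x) : h = 1 := by
  obtain ⟨k, rfl⟩ := (isOfFinOrder_of_finite _).mem_powers_iff_mem_zpowers.2 hh
  have hx' := congrArg Fin.val hx
  simp only [finRotate_pow_apply_val] at hx'
  have hmod : (x + k : ℕ) ≡ x + 0 [MOD m + 1] := by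
    rw [Nat.ModEq, hx', add_zero, Nat.mod_eq_of_lt x.2]
  have hk : k % (m + 1) = 0 := by simpa [Nat.ModEq] using Nat.ModEq.add_left_cancel' _ hmod
  ext y
  simp [finRotate_pow_apply_val, Nat.add_mod, hk, Nat.mod_eq_of_lt y.2]

theorem card_zpowers_finRotate (m : ℕ) :
    Nat.card (Subgroup.zpowers (finRotate (m + 1))) = m + 1 := by
  refine (Nat.card_eq_of_bijective (β := Fin (m + 1))
    (fun h : Subgroup.zpowers (finRotate (m + 1)) => (h : Perm (Fin (m + 1))) 0) ⟨?_, fun y => ?_⟩).trans (Nat.card_fin (m + 1))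
  · intro a b hab
    have h1 : ((b⁻¹ * a : Subgroup.zpowers (finRotate (m + 1))) : Perm (Fin (m + 1))) 0 = 0 := by
      change (b : Perm (Fin (m + 1)))⁻¹ ((a : Perm (Fin (m + 1))) 0) = 0
      rw [show (a : Perm (Fin (m + 1))) 0 = (b : Perm (Fin (m + 1))) 0 from hab]
      simp
    have := eq_one_of_mem_zpowers_finRotate (b⁻¹ * a).2 h1
    exact (inv_mul_eq_one.1 (Subtype.ext this)).symm
  · refine ⟨⟨finRotate (m + 1) ^ (y : ℕ), Subgroup.npow_mem_zpowers _ _⟩, Fin.ext ?_⟩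
    change ((finRotate (m + 1) ^ (y : ℕ)) 0 : ℕ) = y
    rw [finRotate_pow_apply_val]
    simp [Nat.mod_eq_of_lt y.2]

/-- If h has a cycle of length d, then h^d has a fixed point and is trivial by freeness, so every
cycle length is the order of h. -/
theorem parts_cycleShape_of_mem_zpowers {m : ℕ} {h : Perm (Fin (m + 1))}
    (hh : h ∈ Subgroup.zpowers (finRotate (m + 1))) :
    (cycleShape h).parts = Multiset.replicate ((m + 1) / orderOf h) (orderOf h) := by
  have hall : ∀ i ∈ (cycleShape h).parts, i = orderOf h := by
    intro i hi
    rcases Multiset.mem_add.1 (show i ∈ h.cycleType + _ from hi) with hc | hc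
    · rw [cycleType_def, Multiset.mem_map] at hc
      obtain ⟨c, hc, rfl⟩ := hc
      rw [Finset.mem_val] at hc
      have hc' := mem_cycleFactorsFinset_iff.1 hc
      refine Nat.dvd_antisymm ?_ (orderOf_dvd_of_pow_eq_one ?_)
      · rw [← lcm_cycleType]
        exact Multiset.dvd_lcm (by rw [cycleType_def]; exact Multiset.mem_map_of_mem _ hc)
      · obtain ⟨x, hx⟩ := hc'.1.nonempty_support
        refine eq_one_of_mem_zpowers_finRotate (x := x) (Subgroup.pow_mem _ hh _) ?_
        rw [Function.comp_apply, ← hc'.1.orderOf, cycle_is_cycleOf hx hc, ← cycleOf_pow_apply_self,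
          pow_orderOf_eq_one]
        rfl
    · rw [Multiset.mem_replicate] at hc
      have hlt : h.support.card < Fintype.card (Fin (m + 1)) := by omega
      obtain ⟨x, hx⟩ : ∃ x, x ∉ h.support := by
        by_contra! hcon
        rw [Finset.eq_univ_of_forall hcon, Finset.card_univ] at hlt
        exact lt_irrefl _ hlt
      rw [eq_one_of_mem_zpowers_finRotate hh (notMem_support.1 hx), orderOf_one, hc.2]
  have hrep := Multiset.eq_replicate_card.2 hall
  have hsum := (cycleShape h).parts_sum
  rw [hrep, Multiset.sum_replicate, smul_eq_mul] at hsum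
  rw [hrep]
  congr 1
  exact (Nat.div_eq_of_eq_mul_left (orderOf_pos h) hsum.symm).symm

/-- Cycle index of the cyclic group: φ(d) elements have order d, each with i/d cycles of length d.
-/
theorem frob_indCyclic {i : ℕ} (hi : i ≠ 0) :
    (i : ℂ) • frob (indCyclic i) =
      ∑ p ∈ i.divisorsAntidiagonal, (p.1.totient : ℂ) • pSym p.1 ^ p.2 := by
  classical
  obtain ⟨m, rfl⟩ := Nat.exists_eq_succ_of_ne_zero hi
  rw [frob_ind_trivial, card_zpowers_finRotate, smul_smul,
    mul_inv_cancel₀ (Nat.cast_ne_zero.2 hi), one_smul,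
    Nat.sum_divisorsAntidiagonal fun a b => (a.totient : ℂ) • pSym a ^ b,
    ← Finset.sum_fiberwise_of_maps_to (t := (m + 1).divisors)
      (g := fun h : Subgroup.zpowers (finRotate (m + 1)) => orderOf h)]
  · refine Finset.sum_congr rfl fun d hd => ?_
    have hdvd : d ∣ Fintype.card (Subgroup.zpowers (finRotate (m + 1))) := by
      rw [← Nat.card_eq_fintype_card, card_zpowers_finRotate]
      exact Nat.dvd_of_mem_divisors hd
    rw [← IsCyclic.card_orderOf_eq_totient hdvd, Nat.cast_smul_eq_nsmul, ← Finset.sum_const]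
    refine Finset.sum_congr rfl fun h hh => ?_
    rw [pPart, parts_cycleShape_of_mem_zpowers h.2, Subgroup.orderOf_coe,
      (Finset.mem_filter.1 hh).2, Multiset.map_replicate, Multiset.prod_replicate]
  · intro h _
    rw [Nat.mem_divisors]
    refine ⟨?_, hi⟩
    have := orderOf_dvd_natCard h
    rwa [card_zpowers_finRotate] at this

end TwistedConj

namespace TwistedConj

/-! ### A recursion for sums over partitions -/

/-- The multisets of parts of the partitions of `n`. -/
def partsFinset (n : ℕ) : Finset (Multiset ℕ) :=
  (Finset.univ : Finset n.Partition).image Nat.Partition.parts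

theorem mem_partsFinset {n : ℕ} {s : Multiset ℕ} :
    s ∈ partsFinset n ↔ (∀ a ∈ s, 0 < a) ∧ s.sum = n := by
  simp only [partsFinset, Finset.mem_image, Finset.mem_univ, true_and]
  constructor
  · rintro ⟨l, rfl⟩
    exact ⟨fun a ha => l.parts_pos ha, l.parts_sum⟩
  · rintro ⟨h1, h2⟩
    exact ⟨⟨s, fun ha => h1 _ ha, h2⟩, rfl⟩

theorem sum_partition_eq {M : Type*} [AddCommMonoid M] (n : ℕ) (W : Multiset ℕ → M) :
    ∑ l : n.Partition, W l.parts = ∑ s ∈ partsFinset n, W s := by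
  rw [partsFinset, Finset.sum_image fun a _ b _ h => Nat.Partition.ext h]

section

variable {R : Type*} [CommRing R]

/-- The weight `∏ f i m_i` of a multiset with multiplicities `m_i`. -/
def multWeight (f : ℕ → ℕ → R) (s : Multiset ℕ) : R := ∏ i ∈ s.toFinset, f i (s.count i)

theorem multWeight_eq_prod {f : ℕ → ℕ → R} (h0 : ∀ i, f i 0 = 1) {s : Multiset ℕ} {t : Finset ℕ}
    (h : s.toFinset ⊆ t) : multWeight f s = ∏ i ∈ t, f i (s.count i) := by
  refine Finset.prod_subset h fun i _ hi => ?_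
  rw [Multiset.count_eq_zero.2 (by simpa using hi), h0]

theorem sum_divisorsAntidiagonal_Icc {M : Type*} [AddCommMonoid M] (n : ℕ) (F : ℕ → ℕ → M) :
    ∑ s ∈ Finset.Icc 1 n, ∑ p ∈ s.divisorsAntidiagonal, F p.1 p.2 =
      ∑ i ∈ Finset.Icc 1 n, ∑ k ∈ Finset.Icc 1 n, if i * k ≤ n then F i k else 0 := by
  rw [← Finset.sum_product', ← Finset.sum_filter,
    ← Finset.sum_fiberwise_of_maps_to (t := Finset.Icc 1 n) (g := fun p : ℕ × ℕ => p.1 * p.2)]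
  · refine Finset.sum_congr rfl fun s hs => Finset.sum_congr ?_ fun _ _ => rfl
    rw [Finset.mem_Icc] at hs
    ext ⟨a, b⟩
    simp only [Nat.mem_divisorsAntidiagonal, Finset.mem_filter, Finset.mem_product, Finset.mem_Icc]
    constructor
    · rintro ⟨rfl, -⟩
      have ha : 0 < a := Nat.pos_of_mul_pos_right hs.1
      have hb : 0 < b := Nat.pos_of_mul_pos_left hs.1
      exact ⟨⟨⟨⟨ha, (Nat.le_mul_of_pos_right a hb).trans hs.2⟩, hb,
        (Nat.le_mul_of_pos_left b ha).trans hs.2⟩, hs.2⟩, rfl⟩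
    · rintro ⟨-, h⟩
      exact ⟨h, by omega⟩
  · rintro ⟨a, b⟩ h
    simp only [Finset.mem_filter, Finset.mem_product, Finset.mem_Icc] at h ⊢
    exact ⟨Nat.mul_pos h.1.1.1 h.1.2.1, h.2⟩

theorem mul_count_le {n : ℕ} {s : Multiset ℕ} (hs : s.sum = n) (i : ℕ) : s.count i * i ≤ n := by
  obtain ⟨t, ht⟩ := Multiset.le_iff_exists_add.1
    (Multiset.le_count_iff_replicate_le.1 (le_refl (s.count i)))
  rw [← hs]
  conv_rhs => rw [ht, Multiset.sum_add, Multiset.sum_replicate, smul_eq_mul]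
  exact Nat.le_add_right _ _

theorem sum_Icc_ite_le {M : Type*} [AddCommMonoid M] {c n : ℕ} (h : c ≤ n) (G : ℕ → M) :
    (∑ k ∈ Finset.Icc 1 n, if k ≤ c then G k else 0) = ∑ j ∈ Finset.range c, G (j + 1) := by
  rw [← Finset.sum_filter]
  refine Finset.sum_bij' (fun k _ => k - 1) (fun j _ => j + 1) ?_ ?_ ?_ ?_ ?_
  · intro k hk
    simp only [Finset.mem_filter, Finset.mem_Icc, Finset.mem_range] at hk ⊢
    omega
  · intro j hj
    simp only [Finset.mem_filter, Finset.mem_Icc, Finset.mem_range] at hj ⊢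
    omega
  · intro k hk
    simp only [Finset.mem_filter, Finset.mem_Icc] at hk
    omega
  · intro j _
    rfl
  · intro k hk
    simp only [Finset.mem_filter, Finset.mem_Icc] at hk
    rw [Nat.sub_add_cancel hk.1.1]

/-- If the weights `f i c` satisfy Newton's identities with respect to `b i k`, the sums of the
weights over all partitions satisfy a recursion. -/
theorem mul_sum_multWeight {f b : ℕ → ℕ → R} (h0 : ∀ i, f i 0 = 1)
    (h : ∀ i ≠ 0, ∀ c : ℕ, c * f i c = ∑ j ∈ Finset.range c, b i (j + 1) * f i (c - 1 - j))
    (n : ℕ) :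
    n * ∑ l : n.Partition, multWeight f l.parts =
      ∑ s ∈ Finset.Icc 1 n, (∑ p ∈ s.divisorsAntidiagonal, p.1 * b p.1 p.2) *
        ∑ l : (n - s).Partition, multWeight f l.parts := by
  -- Expand n as ∑ i m_i and apply Newton's identity to the factor at i; its k-th term amounts to
  -- deleting k copies of the part i.
  have hstep : ∀ s ∈ partsFinset n, (n : R) * multWeight f s =
      ∑ i ∈ Finset.Icc 1 n, ∑ k ∈ Finset.Icc 1 n, if k ≤ s.count i then
        i * b i k * multWeight f (s - Multiset.replicate k i) else 0 := by
    intro s hs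
    obtain ⟨hpos, hsum⟩ := mem_partsFinset.1 hs
    have hsub : s.toFinset ⊆ Finset.Icc 1 n := fun a ha => by
      rw [Multiset.mem_toFinset] at ha
      exact Finset.mem_Icc.2 ⟨hpos a ha, hsum ▸ Multiset.le_sum_of_mem ha⟩
    have hn : (n : R) = ∑ i ∈ Finset.Icc 1 n, (i : R) * s.count i := by
      have h1 := congrArg (Nat.cast : ℕ → R)
        (hsum.symm.trans (Finset.sum_multiset_count_of_subset s _ hsub))
      rw [h1]
      push_cast
      exact Finset.sum_congr rfl fun i _ => by rw [smul_eq_mul]; push_cast; ring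
    rw [hn, Finset.sum_mul]
    refine Finset.sum_congr rfl fun i hi => ?_
    have hi1 : 1 ≤ i := (Finset.mem_Icc.1 hi).1
    have hcount : s.count i ≤ n :=
      (Nat.le_mul_of_pos_right _ hi1).trans (mul_count_le hsum i)
    rw [sum_Icc_ite_le hcount, mul_assoc, multWeight_eq_prod h0 hsub, ← Finset.mul_prod_erase _ _ hi,
      ← mul_assoc (s.count i : R), h i (by omega), Finset.sum_mul, Finset.mul_sum]
    refine Finset.sum_congr rfl fun j hj => ?_
    have hsub' : (s - Multiset.replicate (j + 1) i).toFinset ⊆ Finset.Icc 1 n := fun a ha => by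
      rw [Multiset.mem_toFinset] at ha
      exact hsub (Multiset.mem_toFinset.2 (Multiset.mem_of_le (Multiset.sub_le_self _ _) ha))
    rw [multWeight_eq_prod h0 hsub', ← Finset.mul_prod_erase _ _ hi, Multiset.count_sub,
      Multiset.count_replicate_self, Nat.sub_sub, add_comm 1 j, mul_assoc, mul_assoc]
    congr 3
    refine Finset.prod_congr rfl fun a ha => ?_
    rw [Multiset.count_sub, Multiset.count_replicate, if_neg (Finset.ne_of_mem_erase ha).symm,
      Nat.sub_zero]
  -- Deleting k copies of i is a bijection onto the partitions of n - ik; if ik > n there is nothing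
  -- to delete.
  have hremove : ∀ i ∈ Finset.Icc 1 n, ∀ k, (∑ s ∈ partsFinset n, if k ≤ s.count i then
      (i : R) * b i k * multWeight f (s - Multiset.replicate k i) else 0) =
        if i * k ≤ n then i * b i k * ∑ s ∈ partsFinset (n - i * k), multWeight f s else 0 := by
    intro i hi k
    rw [← Finset.sum_filter]
    split_ifs with hik
    · rw [Finset.mul_sum]
      refine Finset.sum_bij' (fun s _ => s - Multiset.replicate k i)
        (fun s _ => s + Multiset.replicate k i) ?_ ?_ ?_ ?_ fun _ _ => rfl
      · intro s hs
        rw [Finset.mem_filter, mem_partsFinset, Multiset.le_count_iff_replicate_le] at hs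
        obtain ⟨⟨hpos, hsum⟩, hle⟩ := hs
        obtain ⟨t, rfl⟩ := Multiset.le_iff_exists_add.1 hle
        rw [Multiset.sum_add, Multiset.sum_replicate, smul_eq_mul] at hsum
        rw [mem_partsFinset, add_tsub_cancel_left]
        refine ⟨fun a ha => hpos a (Multiset.mem_add.2 (Or.inr ha)), ?_⟩
        rw [← hsum, mul_comm i k, Nat.add_sub_cancel_left]
      · intro s hs
        obtain ⟨hpos, hsum⟩ := mem_partsFinset.1 hs
        rw [Finset.mem_filter, mem_partsFinset, Multiset.sum_add, hsum, Multiset.sum_replicate,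
          smul_eq_mul, Multiset.count_add, Multiset.count_replicate_self, mul_comm k i,
          Nat.sub_add_cancel hik]
        refine ⟨⟨fun a ha => ?_, rfl⟩, Nat.le_add_left _ _⟩
        rcases Multiset.mem_add.1 ha with ha | ha
        · exact hpos a ha
        · rw [Multiset.eq_of_mem_replicate ha]
          exact (Finset.mem_Icc.1 hi).1
      · intro s hs
        rw [Finset.mem_filter, Multiset.le_count_iff_replicate_le] at hs
        exact tsub_add_cancel_of_le hs.2
      · intro s _
        exact add_tsub_cancel_right _ _
    · refine Finset.sum_eq_zero fun s hs => ?_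
      rw [Finset.mem_filter, mem_partsFinset] at hs
      refine absurd ?_ hik
      rw [mul_comm]
      exact (Nat.mul_le_mul_right i hs.2).trans (mul_count_le hs.1.2 i)
  simp_rw [sum_partition_eq]
  rw [Finset.mul_sum, Finset.sum_congr rfl hstep, Finset.sum_comm]
  have hrhs : ∀ s ∈ Finset.Icc 1 n, (∑ p ∈ s.divisorsAntidiagonal, (p.1 : R) * b p.1 p.2) *
      ∑ t ∈ partsFinset (n - s), multWeight f t =
      ∑ p ∈ s.divisorsAntidiagonal, (p.1 : R) * b p.1 p.2 *
        ∑ t ∈ partsFinset (n - p.1 * p.2), multWeight f t := fun s _ => by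
    rw [Finset.sum_mul]
    refine Finset.sum_congr rfl fun p hp => ?_
    rw [(Nat.mem_divisorsAntidiagonal.1 hp).1]
  rw [Finset.sum_congr rfl hrhs, sum_divisorsAntidiagonal_Icc n fun i k =>
    (i : R) * b i k * ∑ t ∈ partsFinset (n - i * k), multWeight f t]
  refine Finset.sum_congr rfl fun i hi => ?_
  rw [Finset.sum_comm]
  exact Finset.sum_congr rfl fun k _ => hremove i hi k

/-- The sums of weights over partitions agree when the coefficients of their recursions do. -/
theorem sum_multWeight_congr [Algebra ℂ R] {f b f' b' : ℕ → ℕ → R} (h0 : ∀ i, f i 0 = 1)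
    (h : ∀ i ≠ 0, ∀ c : ℕ, c * f i c = ∑ j ∈ Finset.range c, b i (j + 1) * f i (c - 1 - j))
    (h0' : ∀ i, f' i 0 = 1)
    (h' : ∀ i ≠ 0, ∀ c : ℕ, c * f' i c = ∑ j ∈ Finset.range c, b' i (j + 1) * f' i (c - 1 - j))
    (hb : ∀ s : ℕ, ∑ p ∈ s.divisorsAntidiagonal, (p.1 : R) * b p.1 p.2 =
      ∑ p ∈ s.divisorsAntidiagonal, (p.1 : R) * b' p.1 p.2) (n : ℕ) :
    ∑ l : n.Partition, multWeight f l.parts = ∑ l : n.Partition, multWeight f' l.parts := by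
  induction n using Nat.strong_induction_on with
  | _ n ih =>
    rcases Nat.eq_zero_or_pos n with rfl | hn
    · refine Finset.sum_congr rfl fun l _ => ?_
      have : l.parts = 0 := by
        rw [Subsingleton.elim l (Nat.Partition.indiscrete 0)]
        rfl
      rw [this]
      rfl
    · have heq := (mul_sum_multWeight h0 h n).trans ((Finset.sum_congr rfl fun s hs => by
        rw [hb s, ih (n - s) (by rw [Finset.mem_Icc] at hs; omega)]).trans
          (mul_sum_multWeight h0' h' n).symm)
      rw [← nsmul_eq_mul, ← nsmul_eq_mul, ← Nat.cast_smul_eq_nsmul ℂ, ← Nat.cast_smul_eq_nsmul ℂ] at heq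
      have hinv := congrArg (fun x => (n : ℂ)⁻¹ • x) heq
      simpa only [smul_smul, inv_mul_cancel₀ (Nat.cast_ne_zero.2 hn.ne' : (n : ℂ) ≠ 0), one_smul]
        using hinv

end

end TwistedConj

namespace TwistedConj

/-! ### Evaluation of the plethystic sum -/

/-- For odd m every sign is +1 and the totients sum to m. For m = 2r the terms with even first
factor are negated; they are indexed by the factorisations of r, leaving 2r - 2r = 0. -/
theorem sum_neg_one_pow_mul_totient (m : ℕ) :
    ∑ p ∈ m.divisorsAntidiagonal, (-1 : ℂ) ^ (p.1 - 1) * (p.2.totient : ℂ) =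
      if Odd m then (m : ℂ) else 0 := by
  have htot : ∀ m : ℕ, ∑ p ∈ m.divisorsAntidiagonal, (p.2.totient : ℂ) = m := fun m => by
    rw [Nat.sum_divisorsAntidiagonal' fun _ d => (d.totient : ℂ)]
    exact_mod_cast congrArg (Nat.cast : ℕ → ℂ) (Nat.sum_totient m)
  split_ifs with hm
  · rw [← htot m]
    refine Finset.sum_congr rfl fun p hp => ?_
    have hodd : Odd p.1 := by
      have := (Nat.mem_divisorsAntidiagonal.1 hp).1
      rw [← this] at hm
      exact (Nat.odd_mul.1 hm).1
    obtain ⟨a, ha⟩ := hodd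
    rw [ha, Nat.add_sub_cancel, pow_mul]
    simp
  · rw [Nat.not_odd_iff_even, even_iff_two_dvd] at hm
    obtain ⟨r, rfl⟩ := hm
    have hsign : ∀ p ∈ (2 * r).divisorsAntidiagonal, (-1 : ℂ) ^ (p.1 - 1) * (p.2.totient : ℂ) =
        p.2.totient - 2 * if Even p.1 then (p.2.totient : ℂ) else 0 := fun p hp => by
      have hmem := Nat.mem_divisorsAntidiagonal.1 hp
      have hpos : p.1 ≠ 0 := fun h0 => hmem.2 (by rw [← hmem.1, h0, zero_mul])
      split_ifs with he
      · have : Odd (p.1 - 1) := by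
          obtain ⟨a, ha⟩ := he
          exact ⟨a - 1, by omega⟩
        rw [this.neg_one_pow]; ring
      · obtain ⟨a, ha⟩ := Nat.not_even_iff_odd.1 he
        rw [ha, Nat.add_sub_cancel, pow_mul]; simp
    have heven : (∑ p ∈ (2 * r).divisorsAntidiagonal, if Even p.1 then (p.2.totient : ℂ) else 0) =
        r := by
      rw [← Finset.sum_filter, ← htot r]
      refine Finset.sum_bij' (fun p _ => (p.1 / 2, p.2)) (fun p _ => (2 * p.1, p.2)) ?_ ?_ ?_ ?_
        fun _ _ => rfl
      · rintro ⟨a, b⟩ h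
        simp only [Finset.mem_filter, Nat.mem_divisorsAntidiagonal] at h ⊢
        obtain ⟨⟨h1, h2⟩, h3⟩ := h
        obtain ⟨c, rfl⟩ := even_iff_two_dvd.1 h3
        rw [Nat.mul_div_cancel_left _ two_pos]
        exact ⟨Nat.eq_of_mul_eq_mul_left two_pos (by rw [← mul_assoc]; exact h1), by omega⟩
      · rintro ⟨a, b⟩ h
        simp only [Finset.mem_filter, Nat.mem_divisorsAntidiagonal] at h ⊢
        exact ⟨⟨by rw [mul_assoc, h.1], by omega⟩, even_two_mul a⟩
      · rintro ⟨a, b⟩ h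
        obtain ⟨c, hc⟩ := even_iff_two_dvd.1 (Finset.mem_filter.1 h).2
        simp only at hc
        simp [hc]
      · rintro ⟨a, b⟩ _
        simp
    rw [Finset.sum_congr rfl hsign, Finset.sum_sub_distrib, ← Finset.mul_sum, heven, htot]
    push_cast; ring

/-- The coefficients in Newton's identities for the plethysms `e_k[g]`. -/
def newtonCoeff (g : MvPowerSeries ℕ ℂ) (k : ℕ) : MvPowerSeries ℕ ℂ :=
  if h : k ≠ 0 then (-1) ^ (k - 1) * MvPowerSeries.expand k h g else 0

theorem mul_newtonCoeff_frob_indCyclic {i k : ℕ} (hi : i ≠ 0) (hk : k ≠ 0) :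
    (i : MvPowerSeries ℕ ℂ) * newtonCoeff (frob (indCyclic i)) k =
      ∑ p ∈ i.divisorsAntidiagonal,
        ((-1) ^ (k - 1) * (p.1.totient : ℂ)) • pSym (k * p.1) ^ p.2 := by
  have h := congrArg (MvPowerSeries.expand k hk) (frob_indCyclic hi)
  rw [map_smul, map_sum, Nat.cast_smul_eq_nsmul, nsmul_eq_mul] at h
  rw [newtonCoeff, dif_pos hk, mul_left_comm, h, Finset.mul_sum]
  refine Finset.sum_congr rfl fun p _ => ?_
  rw [map_smul, map_pow, expand_pSym, mul_smul, mul_smul_comm]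
  rcases Nat.even_or_odd (k - 1) with h | h <;> simp [h.neg_one_pow]

/-- Both sides become sums over k d e = s: the left groups d with e, the right groups k with d, and
the totient identity evaluates the sum over kd = m. -/
theorem sum_mul_newtonCoeff (s : ℕ) :
    ∑ p ∈ s.divisorsAntidiagonal,
        (p.1 : MvPowerSeries ℕ ℂ) * newtonCoeff (frob (indCyclic p.1)) p.2 =
      ∑ p ∈ s.divisorsAntidiagonal,
        (p.1 : MvPowerSeries ℕ ℂ) * if Odd p.1 then pSym p.1 ^ p.2 else 0 := by
  have hleft : ∀ p ∈ s.divisorsAntidiagonal,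
      (p.1 : MvPowerSeries ℕ ℂ) * newtonCoeff (frob (indCyclic p.1)) p.2 =
        ∑ q ∈ p.1.divisorsAntidiagonal,
          ((-1) ^ (p.2 - 1) * (q.1.totient : ℂ)) • pSym (p.2 * q.1) ^ q.2 := fun p hp => by
    have hmem := Nat.mem_divisorsAntidiagonal.1 hp
    exact mul_newtonCoeff_frob_indCyclic (fun h0 => hmem.2 (by rw [← hmem.1, h0, zero_mul]))
      (fun h0 => hmem.2 (by rw [← hmem.1, h0, mul_zero]))
  have hright : ∀ p ∈ s.divisorsAntidiagonal,
      ((p.1 : MvPowerSeries ℕ ℂ) * if Odd p.1 then pSym p.1 ^ p.2 else 0) =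
        ∑ q ∈ p.1.divisorsAntidiagonal,
          ((-1) ^ (q.1 - 1) * (q.2.totient : ℂ)) • pSym p.1 ^ p.2 := fun p _ => by
    rw [← Finset.sum_smul, sum_neg_one_pow_mul_totient]
    split_ifs
    · rw [Nat.cast_smul_eq_nsmul, nsmul_eq_mul]
    · simp
  rw [Finset.sum_congr rfl hleft, Finset.sum_congr rfl hright, Finset.sum_sigma', Finset.sum_sigma']
  refine Finset.sum_bij' (fun x _ => ⟨(x.1.2 * x.2.1, x.2.2), (x.1.2, x.2.1)⟩)
    (fun x _ => ⟨(x.2.2 * x.1.2, x.2.1), (x.2.2, x.1.2)⟩) ?_ ?_ ?_ ?_ fun _ _ => rfl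
  · rintro ⟨⟨i, k⟩, ⟨d, e⟩⟩ h
    simp only [Finset.mem_sigma, Nat.mem_divisorsAntidiagonal] at h ⊢
    obtain ⟨⟨rfl, h1⟩, rfl, h2⟩ := h
    simp only [mul_ne_zero_iff, ne_eq] at h1 h2 ⊢
    exact ⟨⟨by ring, h1⟩, trivial, h1.2, h2.1⟩
  · rintro ⟨⟨m, e⟩, ⟨k, d⟩⟩ h
    simp only [Finset.mem_sigma, Nat.mem_divisorsAntidiagonal] at h ⊢
    obtain ⟨⟨rfl, h1⟩, rfl, h2⟩ := h
    simp only [mul_ne_zero_iff, ne_eq] at h1 h2 ⊢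
    exact ⟨⟨by ring, h1⟩, trivial, h2.2, h1.2⟩
  · rintro ⟨⟨i, k⟩, ⟨d, e⟩⟩ h
    simp only [Finset.mem_sigma, Nat.mem_divisorsAntidiagonal] at h ⊢
    rw [h.2.1]
  · rintro ⟨⟨m, e⟩, ⟨k, d⟩⟩ h
    simp only [Finset.mem_sigma, Nat.mem_divisorsAntidiagonal] at h ⊢
    rw [h.2.1]

theorem newtonCoeff_succ (g : MvPowerSeries ℕ ℂ) (j : ℕ) :
    newtonCoeff g (j + 1) = (-1) ^ j * MvPowerSeries.expand (j + 1) j.succ_ne_zero g := by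
  rw [newtonCoeff, dif_pos j.succ_ne_zero, Nat.add_sub_cancel]

theorem sum_ePleth (n : ℕ) :
    ∑ l : n.Partition, ePleth l (fun i => frob (indCyclic i)) =
      ∑ l ∈ Nat.Partition.odds n, pPart l := by
  classical
  -- For even i the weight is 1 at multiplicity 0 and 0 otherwise, so exactly the partitions into
  -- odd parts survive, with weight p_l.
  let f' : ℕ → ℕ → MvPowerSeries ℕ ℂ := fun i c =>
    if Odd i then pSym i ^ c else if c = 0 then 1 else 0
  have hsum := sum_multWeight_congr (f := fun i c => plethysm (eSym c) (frob (indCyclic i)))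
    (b := fun i k => newtonCoeff (frob (indCyclic i)) k) (f' := f')
    (b' := fun i k => if Odd i then pSym i ^ k else 0)
    (fun i => plethysm_eSym_zero _)
    (fun i _ c => by simp only [newtonCoeff_succ]; exact newton_plethysm _ c)
    (fun i => by simp [f'])
    (fun i _ c => by
      by_cases hi : Odd i
      · simp only [f', if_pos hi, ← pow_add]
        rw [Finset.sum_congr rfl fun j hj => by
          rw [show j + 1 + (c - 1 - j) = c by rw [Finset.mem_range] at hj; omega]]
        simp
      · simp only [f', if_neg hi, zero_mul, Finset.sum_const_zero]
        split_ifs with hc <;> simp [hc])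
    sum_mul_newtonCoeff n
  refine hsum.trans ?_
  rw [← Finset.sum_subset (Finset.subset_univ (Nat.Partition.odds n))]
  · refine Finset.sum_congr rfl fun l hl => ?_
    rw [mem_odds_iff] at hl
    rw [pPart, Finset.prod_multiset_map_count, multWeight]
    refine Finset.prod_congr rfl fun i hi => ?_
    exact if_pos (Nat.not_even_iff_odd.1 (hl i (Multiset.mem_toFinset.1 hi)))
  · intro l _ hl
    rw [mem_odds_iff] at hl
    push Not at hl
    obtain ⟨i, hi, he⟩ := hl
    refine Finset.prod_eq_zero (Multiset.mem_toFinset.2 hi) ?_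
    simp only [f', if_neg (Nat.not_odd_iff_even.2 he),
      if_neg (Multiset.count_ne_zero.2 hi)]

end TwistedConj

end
open TwistedConj in
theorem theorem4p6 (n : ℕ) :
    frob (twistedConj n) = ∑ l : n.Partition, ePleth l (fun i => frob (indCyclic i)) ∧
    frob (twistedConj n) = ∑ l ∈ Nat.Partition.odds n, pPart l ∧
    Nonempty (((twistedConj n).tprod (sgnRep n)).Equiv (twistedConj n)) ∧
    Module.finrank ℂ (TwistedSpace n) = n.factorial ∧
    ∀ ν : n.Partition, ∃ k : ℕ, ∑ l ∈ Nat.Partition.odds n, irrChar ν l = (k : ℂ) :=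
  ⟨(frob_twistedConj n).trans (sum_ePleth n).symm, frob_twistedConj n,
    nonempty_twistedConj_tprod_sgnRep_equiv n, finrank_twistedSpace n, sum_irrChar_odds⟩
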